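/- \textbf{Definitions.} A \emph{proximity poset} $(S,\le,\prec)$ is a poset $(S,\le)$ with a relation $\prec$ on $S$ such that for all $a,b\in S$: $\{x \mid x\prec b\}$ is an ideal (a nonempty, directed, downward closed subset), $\{y\mid a\prec y\}$ is upward closed, and $a\prec b \iff \exists c\,(a\prec c\prec b)$. An \emph{approximable relation} $r\colon S\to S'$ between proximity posets is a relation $r\subseteq S\times S'$ such that $\{a\mid a\mathrel r b\}$ is an ideal for each $b \in S'$, $\{b\mid a\mathrel r b\}$ is upward closed for each $a \in S$, and $a\mathrel r b\iff \exists a'\,(a\prec a'\mathrel r b)\iff\exists b'\,(a\mathrel r b'\prec' b)$. Let $\mathsf{PxPos}$ be the category of proximity posets and approximable relations, with relational composition, the identity on $S$ being $\prec$. For a relation $r\subseteq S\times S'$ and finite subsets $A\subseteq S$, $B\subseteq S'$ put $A\mathrel{r_L}B\iff\forall a\in A\,\exists b\in B\,(a\mathrel r b)$ and $A\mathrel{r_U}B\iff\forall b\in B\,\exists a\in A\,(a\mathrel r b)$. For $X\in\{L,U\}$, let $\mathrm P_X(S)$ be the poset reflection of the set $\mathrm{Fin}(S)$ of finite subsets of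 $S$ preordered by $\le_X$, equipped with the relation $\prec_X$, and let $\mathrm P_X(r)=r_X$. With $A\mathrel{\varepsilon^X}a\iff A\prec_X\{a\}$ and $A\mathrel{\nu^X}\mathcal U\iff A\prec_X\bigcup\mathcal U$, $\mathrm P_L$ and $\mathrm P_U$ are comonads on $\mathsf{PxPos}$ (the lower and upper powerlocale). For $\mathcal V\in\mathrm{Fin}(\mathrm{Fin}(S))$ let $\mathcal V^{*}$ be the finite set of all $B\subseteq\bigcup\mathcal V$ that meet every member of $\mathcal V$. The relations $\sigma_S\colon \mathrm P_U\mathrm P_L S\to\mathrm P_L\mathrm P_U S$, $\mathcal U\mathrel{\sigma_S}\mathcal V\iff\mathcal U\mathrel{(\prec_L)_U}\mathcal V^{*}$, form a distributive law of comonads of $\mathrm P_L$ over $\mathrm P_U$. The \emph{double powerlocale} is the resulting composite comonad $\mathrm P_U\circ\mathrm P_L$ on $\mathsf{PxPos}$, with counit $\varepsilon^{U}\circ\mathrm P_U\varepsilon^{L}$ and comultiplication $\mathrm P_U(\sigma_{\mathrm P_L})\circ\nu^{U}_{\mathrm P_L\mathrm P_L}\circ\mathrm P_U\nu^{L}$.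 A \emph{locale} is an object of the opposite of the category of frames and frame homomorphisms. In a complete lattice, $y$ is \emph{way below} $x$ if every directed (in particular nonempty) subset $D$ with $x\le\bigvee D$ has an element $z \in D$ with $y\le z$. A locale is \emph{locally compact} if its frame is a continuous lattice, that is, for every element $x$ the set of elements way below $x$ is directed with join $x$. \textbf{Theorem.} The category of coalgebras and coalgebra homomorphisms of the double powerlocale $\mathrm P_U\circ\mathrm P_L$ on $\mathsf{PxPos}$ is equivalent to the category of locally compact locales (the full subcategory of the category of locales on the locally compact ones). -/

import Mathlib

open CategoryTheory

universe v u

/-! ### Composite comonads -/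

/-- A distributive law of the comonad `K` over the comonad `T`: a natural transformation
`T ∘ K ⟶ K ∘ T` (note that `K ⋙ T` is the functor `X ↦ T (K X)`) which is compatible with the
counits and with the comultiplications of `K` and `T`. -/
structure ComonadDistributiveLaw {C : Type u} [Category.{v} C] (K T : Comonad C) where
  σ : K.toFunctor ⋙ T.toFunctor ⟶ T.toFunctor ⋙ K.toFunctor
  counit_T : ∀ X : C, σ.app X ≫ K.map (T.ε.app X) = T.ε.app (K.obj X)
  counit_K : ∀ X : C, σ.app X ≫ K.ε.app (T.obj X) = T.map (K.ε.app X)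
  comult_K : ∀ X : C, T.map (K.δ.app X) ≫ σ.app (K.obj X) ≫ K.map (σ.app X) =
    σ.app X ≫ K.δ.app (T.obj X)
  comult_T : ∀ X : C, T.δ.app (K.obj X) ≫ T.map (σ.app X) ≫ σ.app (T.obj X) =
    σ.app X ≫ K.map (T.δ.app X)

namespace ComonadDistributiveLaw

variable {C : Type u} [Category.{v} C] {K T : Comonad C}

/-- The composite comonad `T ∘ K` induced by a distributive law of `K` over `T`. -/
def composite (d : ComonadDistributiveLaw K T) : Comonad C where
  toFunctor := K.toFunctor ⋙ T.toFunctor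
  ε :=
    { app := fun X => T.map (K.ε.app X) ≫ T.ε.app X
      naturality := by
        intro X Y f
        have h := K.ε.naturality f
        have h' := T.ε.naturality f
        dsimp only [Functor.comp_obj, Functor.comp_map, Functor.id_obj, Functor.id_map] at h h' ⊢
        rw [← T.map_comp_assoc, h, T.map_comp_assoc, h', Category.assoc] }
  δ :=
    { app := fun X =>
        T.map (K.δ.app X) ≫ T.δ.app (K.obj (K.obj X)) ≫ T.map (d.σ.app (K.obj X))
      naturality := by
        intro X Y f
        have h1 := K.δ.naturality f
        have h2 := T.δ.naturality (K.map (K.map f))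
        have h3 := d.σ.naturality (K.map f)
        dsimp only [Functor.comp_obj, Functor.comp_map] at h1 h2 h3 ⊢
        rw [← T.map_comp_assoc, h1, T.map_comp_assoc, reassoc_of% h2, ← T.map_comp, h3,
          T.map_comp]
        simp only [Category.assoc] }
  coassoc := by
    intro X
    have nT : ∀ {A B : C} (f : A ⟶ B), T.map f ≫ T.δ.app B = T.δ.app A ≫ T.map (T.map f) :=
      fun f => T.δ.naturality f
    have nσ : ∀ {A B : C} (f : A ⟶ B),
        T.map (K.map f) ≫ d.σ.app B = d.σ.app A ≫ K.map (T.map f) := fun f => d.σ.naturality f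
    have e2 := congrArg T.map (d.comult_K (K.obj X))
    have hL : d.σ.app (K.obj X) ≫ K.map (T.map (K.δ.app X) ≫ T.δ.app (K.obj (K.obj X)) ≫
        T.map (d.σ.app (K.obj X))) =
        T.map (K.map (K.δ.app X)) ≫ T.δ.app (K.obj (K.obj (K.obj X))) ≫
          T.map (d.σ.app (K.obj (K.obj X))) ≫ T.map (K.map (d.σ.app (K.obj X))) ≫
          d.σ.app (K.obj (T.obj (K.obj X))) := by
      have n1 := nσ (K.δ.app X)
      have n2 := nσ (d.σ.app (K.obj X))
      dsimp only [Functor.comp_obj] at n1 n2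
      rw [K.map_comp, K.map_comp, ← reassoc_of% n1, ← reassoc_of% (d.comult_T (K.obj (K.obj X))),
        n2]
    have s1 : T.map (d.σ.app (K.obj (K.obj X))) ≫ T.map (K.map (d.σ.app (K.obj X))) ≫
        T.δ.app (K.obj (K.obj (T.obj (K.obj X)))) =
        T.δ.app (T.obj (K.obj (K.obj (K.obj X)))) ≫ T.map (T.map (d.σ.app (K.obj (K.obj X)))) ≫
          T.map (T.map (K.map (d.σ.app (K.obj X)))) := by
      have m1 := nT (d.σ.app (K.obj (K.obj X)))
      have m2 := nT (K.map (d.σ.app (K.obj X)))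
      dsimp only [Functor.comp_obj] at m1 m2
      rw [m2, reassoc_of% m1]
    have m3 := nT (K.δ.app (K.obj X))
    have m4 := nT (K.map (K.δ.app X))
    have c := T.coassoc (K.obj (K.obj (K.obj X)))
    have k := K.coassoc X
    dsimp only [Functor.comp_obj, Functor.comp_map] at m3 m4 c k hL s1 e2 ⊢
    simp only [Category.assoc]
    rw [← T.map_comp, hL]
    simp only [T.map_comp] at e2 ⊢
    rw [← reassoc_of% e2, reassoc_of% s1, ← reassoc_of% m3, ← reassoc_of% m4,
      reassoc_of% c, ← T.map_comp_assoc (K.δ.app X), k, T.map_comp_assoc]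
  left_counit := by
    intro X
    have n := T.δ.naturality (K.ε.app (K.obj X))
    have e := d.counit_K (K.obj X)
    dsimp only [Functor.comp_obj, Functor.comp_map, Functor.id_obj, Functor.id_map] at n e ⊢
    simp only [Category.assoc]
    rw [← T.map_comp_assoc (d.σ.app _), e, ← reassoc_of% n, T.left_counit, Category.comp_id,
      ← T.map_comp, K.left_counit, T.map_id]
  right_counit := by
    intro X
    have n := T.δ.naturality (K.map (K.ε.app X))
    have e := d.counit_T X
    have m := d.σ.naturality (K.ε.app X)
    dsimp only [Functor.comp_obj, Functor.comp_map, Functor.id_obj, Functor.id_map] at n e m ⊢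
    simp only [Category.assoc]
    rw [← T.map_comp (d.σ.app _), K.map_comp, ← reassoc_of% m, e, T.map_comp, ← reassoc_of% n,
      T.right_counit, Category.comp_id, ← T.map_comp, K.right_counit, T.map_id]

end ComonadDistributiveLaw

/-! ### Proximity posets and approximable relations -/

/-- A relation `r` between posets is approximable if every `{a | r a b}` is an ideal
(a nonempty, directed lower set) and every `{b | r a b}` is an upper set. -/
structure IsApproximable {S S' : Type u} [PartialOrder S] [PartialOrder S']
    (r : S → S' → Prop) : Prop where
  isIdeal : ∀ b, Order.IsIdeal {a | r a b}
  isUpperSet : ∀ a, IsUpperSet {b | r a b}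

/-- A proximity poset: a poset with a relation `prec` (written `≺`) such that every `{a | a ≺ b}` is
a rounded ideal and every `{b | a ≺ b}` is a rounded upper set. -/
structure PxPos : Type (u + 1) where
  carrier : Type u
  [order : PartialOrder carrier]
  prec : carrier → carrier → Prop
  approx : IsApproximable prec
  rounded : ∀ a b, prec a b ↔ ∃ c, prec a c ∧ prec c b

namespace PxPos

instance : CoeSort PxPos.{u} (Type u) := ⟨PxPos.carrier⟩

instance (S : PxPos.{u}) : PartialOrder S := S.order

/-- Approximable relations between proximity posets: approximable relations between the underlying
posets that are unchanged by composition with `≺` on either side. -/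
@[ext]
structure Hom (S S' : PxPos.{u}) : Type u where
  rel : S → S' → Prop
  approx : IsApproximable rel
  rounded_left : ∀ a b, rel a b ↔ ∃ a', S.prec a a' ∧ rel a' b
  rounded_right : ∀ a b, rel a b ↔ ∃ b', rel a b' ∧ S'.prec b' b

variable {S S' S'' : PxPos.{u}}

theorem prec_le_left {a a' b : S} (h : a ≤ a') (h' : S.prec a' b) : S.prec a b :=
  (S.approx.isIdeal b).IsLowerSet h h'

theorem prec_le_right {a b b' : S} (h' : S.prec a b) (h : b ≤ b') : S.prec a b' :=
  S.approx.isUpperSet a h h'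

theorem prec_trans {a b c : S} (h : S.prec a b) (h' : S.prec b c) : S.prec a c :=
  (S.rounded a c).2 ⟨b, h, h'⟩

namespace Hom

theorem le_left (r : Hom S S') {a a' : S} {b : S'} (h : a ≤ a') (h' : r.rel a' b) : r.rel a b :=
  (r.approx.isIdeal b).IsLowerSet h h'

theorem le_right (r : Hom S S') {a : S} {b b' : S'} (h' : r.rel a b) (h : b ≤ b') : r.rel a b' :=
  r.approx.isUpperSet a h h'

theorem prec_left (r : Hom S S') {a a' : S} {b : S'} (h : S.prec a a') (h' : r.rel a' b) :
    r.rel a b :=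
  (r.rounded_left a b).2 ⟨a', h, h'⟩

theorem prec_right (r : Hom S S') {a : S} {b b' : S'} (h' : r.rel a b) (h : S'.prec b b') :
    r.rel a b' :=
  (r.rounded_right a b').2 ⟨b, h', h⟩

/-- The identity on `S` is the relation `≺`. -/
def id (S : PxPos.{u}) : Hom S S where
  rel := S.prec
  approx := S.approx
  rounded_left := S.rounded
  rounded_right := S.rounded

/-- Composition of approximable relations is relational composition. -/
def comp (r : Hom S S') (s : Hom S' S'') : Hom S S'' where
  rel a c := ∃ b, r.rel a b ∧ s.rel b c
  approx :=
    { isIdeal := by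
        intro c
        refine ⟨?_, ?_, ?_⟩
        · rintro a' a h ⟨b, h1, h2⟩
          exact ⟨b, r.le_left h h1, h2⟩
        · obtain ⟨b, hb⟩ := (s.approx.isIdeal c).Nonempty
          obtain ⟨a, ha⟩ := (r.approx.isIdeal b).Nonempty
          exact ⟨a, b, ha, hb⟩
        · rintro a ⟨b, h1, h2⟩ a' ⟨b', h1', h2'⟩
          obtain ⟨d, hd, hbd, hbd'⟩ := (s.approx.isIdeal c).Directed b h2 b' h2'
          obtain ⟨e, he, hae, hae'⟩ := (r.approx.isIdeal d).Directed a (r.le_right h1 hbd)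
            a' (r.le_right h1' hbd')
          exact ⟨e, ⟨d, he, hd⟩, hae, hae'⟩
      isUpperSet := by
        rintro a c c' h ⟨b, h1, h2⟩
        exact ⟨b, h1, s.le_right h2 h⟩ }
  rounded_left := by
    intro a c
    constructor
    · rintro ⟨b, h1, h2⟩
      obtain ⟨a', h, h'⟩ := (r.rounded_left a b).1 h1
      exact ⟨a', h, b, h', h2⟩
    · rintro ⟨a', h, b, h', h2⟩
      exact ⟨b, r.prec_left h h', h2⟩
  rounded_right := by
    intro a c
    constructor
    · rintro ⟨b, h1, h2⟩
      obtain ⟨c', h, h'⟩ := (s.rounded_right b c).1 h2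
      exact ⟨c', ⟨b, h1, h⟩, h'⟩
    · rintro ⟨c', ⟨b, h1, h⟩, h'⟩
      exact ⟨b, h1, s.prec_right h h'⟩

end Hom

/-- The category of proximity posets and approximable relations. -/
instance : Category.{u} PxPos.{u} where
  Hom := Hom
  id := Hom.id
  comp := Hom.comp
  id_comp r := Hom.ext (by funext a b; exact propext (r.rounded_left a b).symm)
  comp_id r := Hom.ext (by funext a b; exact propext (r.rounded_right a b).symm)
  assoc r s t := Hom.ext (by
    funext a d
    exact propext ⟨fun ⟨c, ⟨b, h1, h2⟩, h3⟩ => ⟨b, h1, c, h2, h3⟩,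
      fun ⟨b, h1, c, h2, h3⟩ => ⟨c, ⟨b, h1, h2⟩, h3⟩⟩)

theorem hom_ext {r s : S ⟶ S'} (h : ∀ a b, r.rel a b ↔ s.rel a b) : r = s :=
  Hom.ext (by funext a b; exact propext (h a b))

theorem id_rel (a b : S) : Hom.rel (𝟙 S) a b ↔ S.prec a b := Iff.rfl

theorem comp_rel (r : S ⟶ S') (s : S' ⟶ S'') (a : S) (c : S'') :
    Hom.rel (r ≫ s) a c ↔ ∃ b, r.rel a b ∧ s.rel b c := Iff.rfl

end PxPos

/-! ### Lower and upper extensions of relations to finite subsets -/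

section Extensions

variable {α β γ : Type u}

/-- The lower extension of a relation to finite subsets. -/
def lowerExt (r : α → β → Prop) (A : Finset α) (B : Finset β) : Prop :=
  ∀ a ∈ A, ∃ b ∈ B, r a b

/-- The upper extension of a relation to finite subsets. -/
def upperExt (r : α → β → Prop) (A : Finset α) (B : Finset β) : Prop :=
  ∀ b ∈ B, ∃ a ∈ A, r a b

open Classical in
/-- Finite choice. -/
theorem exists_finset_choice (A : Finset α) {p : α → β → Prop} (h : ∀ a ∈ A, ∃ b, p a b) :
    ∃ B : Finset β, (∀ a ∈ A, ∃ b ∈ B, p a b) ∧ ∀ b ∈ B, ∃ a ∈ A, p a b := by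
  choose f hf using h
  refine ⟨A.attach.image fun a => f a.1 a.2, fun a ha =>
    ⟨f a ha, Finset.mem_image.2 ⟨⟨a, ha⟩, Finset.mem_attach _ _, rfl⟩, hf a ha⟩, fun b hb => ?_⟩
  obtain ⟨a, -, rfl⟩ := Finset.mem_image.1 hb
  exact ⟨a.1, a.2, hf a.1 a.2⟩

open Classical in
/-- For a finite family `U` of finite sets, `finsetStar U` is the finite family of all sets
`⋃ A ∈ U, f A` where `f A` is a nonempty subset of `A` for each `A ∈ U`; equivalently, it consists
of the subsets of `⋃ U` that meet every member of `U`. -/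
noncomputable def finsetStar (U : Finset (Finset α)) : Finset (Finset α) :=
  (U.biUnion id).powerset.filter fun B => ∀ A ∈ U, ∃ a ∈ A, a ∈ B

open Classical in
theorem finsetStar_empty : finsetStar (∅ : Finset (Finset α)) = {∅} := by
  ext B
  simp [finsetStar]

open Classical in
/-- The recursive description of `finsetStar`. -/
theorem mem_finsetStar_insert (U : Finset (Finset α)) (A D : Finset α) :
    D ∈ finsetStar (insert A U) ↔
      ∃ B ∈ finsetStar U, ∃ C, C ⊆ A ∧ C.Nonempty ∧ D = B ∪ C := by
  simp only [finsetStar, Finset.mem_filter, Finset.mem_powerset]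
  constructor
  · rintro ⟨h1, h2⟩
    refine ⟨D ∩ U.biUnion id, ⟨Finset.inter_subset_right, ?_⟩, D ∩ A, Finset.inter_subset_right,
      ?_, ?_⟩
    · intro A' hA'
      obtain ⟨a, ha, haD⟩ := h2 A' (Finset.mem_insert_of_mem hA')
      exact ⟨a, ha, Finset.mem_inter.2 ⟨haD, Finset.mem_biUnion.2 ⟨A', hA', ha⟩⟩⟩
    · obtain ⟨a, ha, haD⟩ := h2 A (Finset.mem_insert_self _ _)
      exact ⟨a, Finset.mem_inter.2 ⟨haD, ha⟩⟩
    · ext d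
      constructor
      · intro hd
        obtain ⟨A', hA', hd'⟩ := Finset.mem_biUnion.1 (h1 hd)
        rcases Finset.mem_insert.1 hA' with rfl | hA'
        · exact Finset.mem_union_right _ (Finset.mem_inter.2 ⟨hd, hd'⟩)
        · exact Finset.mem_union_left _
            (Finset.mem_inter.2 ⟨hd, Finset.mem_biUnion.2 ⟨A', hA', hd'⟩⟩)
      · intro hd
        rcases Finset.mem_union.1 hd with hd | hd <;> exact (Finset.mem_inter.1 hd).1
  · rintro ⟨B, ⟨h1, h2⟩, C, hC, ⟨c, hc⟩, rfl⟩
    refine ⟨?_, ?_⟩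
    · refine Finset.union_subset (h1.trans ?_) (hC.trans ?_)
      · exact Finset.biUnion_subset_biUnion_of_subset_left _ (Finset.subset_insert _ _)
      · exact Finset.subset_biUnion_of_mem id (Finset.mem_insert_self _ _)
    · intro A' hA'
      rcases Finset.mem_insert.1 hA' with rfl | hA'
      · exact ⟨c, hC hc, Finset.mem_union_right _ hc⟩
      · obtain ⟨a, ha, haB⟩ := h2 A' hA'
        exact ⟨a, ha, Finset.mem_union_left _ haB⟩

open Classical in
theorem finsetStar_meets {U : Finset (Finset α)} {A B : Finset α} (hB : B ∈ finsetStar U)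
    (hA : A ∈ U) : ∃ a ∈ A, a ∈ B :=
  (Finset.mem_filter.1 hB).2 A hA

open Classical in
theorem exists_mem_finsetStar (U : Finset (Finset α)) (X : α → Prop)
    (h : ∀ A ∈ U, ∃ a ∈ A, X a) : ∃ B ∈ finsetStar U, ∀ b ∈ B, X b := by
  refine ⟨(U.biUnion id).filter X, Finset.mem_filter.2 ⟨?_, ?_⟩, ?_⟩
  · exact Finset.mem_powerset.2 (Finset.filter_subset _ _)
  · intro A hA
    obtain ⟨a, ha, hX⟩ := h A hA
    exact ⟨a, ha, Finset.mem_filter.2 ⟨Finset.mem_biUnion.2 ⟨A, hA, ha⟩, hX⟩⟩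
  · intro b hb
    exact (Finset.mem_filter.1 hb).2

theorem exists_mem_finsetStar_or (U : Finset (Finset α)) (X : α → Prop) :
    (∃ B ∈ finsetStar U, ∀ b ∈ B, X b) ∨ ∃ A ∈ U, ∀ a ∈ A, ¬ X a := by
  by_cases h : ∀ A ∈ U, ∃ a ∈ A, X a
  · exact Or.inl (exists_mem_finsetStar U X h)
  · push Not at h
    exact Or.inr h

theorem finsetStar_duality (r : α → β → Prop) (U : Finset (Finset α)) (V : Finset (Finset β)) :
    (∀ B ∈ finsetStar V, ∃ A ∈ U, lowerExt r A B) ↔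
      ∀ X ∈ finsetStar U, ∃ C ∈ V, upperExt r X C := by
  constructor
  · intro h X hX
    rcases exists_mem_finsetStar_or V (fun b => ¬ ∃ a ∈ X, r a b) with ⟨B, hB, hB'⟩ | ⟨C, hC, hC'⟩
    · obtain ⟨A, hA, hAB⟩ := h B hB
      obtain ⟨a, ha, haX⟩ := finsetStar_meets hX hA
      obtain ⟨b, hb, hab⟩ := hAB a ha
      exact absurd ⟨a, haX, hab⟩ (hB' b hb)
    · exact ⟨C, hC, fun c hc => not_not.1 (hC' c hc)⟩
  · intro h B hB
    rcases exists_mem_finsetStar_or U (fun a => ¬ ∃ b ∈ B, r a b) with ⟨X, hX, hX'⟩ | ⟨A, hA, hA'⟩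
    · obtain ⟨C, hC, hXC⟩ := h X hX
      obtain ⟨b, hb, hbB⟩ := finsetStar_meets hB hC
      obtain ⟨a, ha, hab⟩ := hXC b hb
      exact absurd ⟨b, hbB, hab⟩ (hX' a ha)
    · exact ⟨A, hA, fun a ha => not_not.1 (hA' a ha)⟩

end Extensions

/-! ### The poset reflections of the finite subsets -/

/-- The finite subsets of `S`, to be preordered by the lower extension of `≤`. -/
def LowerFin (S : Type u) : Type u := Finset S

/-- The finite subsets of `S`, to be preordered by the upper extension of `≤`. -/
def UpperFin (S : Type u) : Type u := Finset S

section

variable {S : Type u} [PartialOrder S]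

instance : Preorder (LowerFin S) where
  le A B := lowerExt (· ≤ ·) (A : Finset S) (B : Finset S)
  le_refl _ := fun a ha => ⟨a, ha, le_rfl⟩
  le_trans _ _ _ h h' := fun a ha =>
    let ⟨b, hb, hab⟩ := h a ha
    let ⟨c, hc, hbc⟩ := h' b hb
    ⟨c, hc, hab.trans hbc⟩

instance : Preorder (UpperFin S) where
  le A B := upperExt (· ≤ ·) (A : Finset S) (B : Finset S)
  le_refl _ := fun a ha => ⟨a, ha, le_rfl⟩
  le_trans _ _ _ h h' := fun c hc =>
    let ⟨b, hb, hbc⟩ := h' c hc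
    let ⟨a, ha, hab⟩ := h b hb
    ⟨a, ha, hab.trans hbc⟩

variable (S) in
/-- The poset reflection of the finite subsets of `S` with the lower preorder. -/
def LowerPt : Type u := Antisymmetrization (LowerFin S) (· ≤ ·)

variable (S) in
/-- The poset reflection of the finite subsets of `S` with the upper preorder. -/
def UpperPt : Type u := Antisymmetrization (UpperFin S) (· ≤ ·)

noncomputable instance : PartialOrder (LowerPt S) :=
  inferInstanceAs (PartialOrder (Antisymmetrization (LowerFin S) (· ≤ ·)))

noncomputable instance : PartialOrder (UpperPt S) :=
  inferInstanceAs (PartialOrder (Antisymmetrization (UpperFin S) (· ≤ ·)))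

namespace LowerPt

/-- The class of a finite set. -/
def mk (A : Finset S) : LowerPt S := toAntisymmetrization (α := LowerFin S) (· ≤ ·) A

/-- A finite set that represents a given class. -/
noncomputable def rep (x : LowerPt S) : Finset S :=
  ofAntisymmetrization (α := LowerFin S) (· ≤ ·) x

theorem mk_rep (x : LowerPt S) : mk x.rep = x :=
  toAntisymmetrization_ofAntisymmetrization (α := LowerFin S) (· ≤ ·) x

theorem mk_le_mk {A B : Finset S} : mk A ≤ mk B ↔ lowerExt (· ≤ ·) A B := Iff.rfl

theorem le_iff {x y : LowerPt S} : x ≤ y ↔ lowerExt (· ≤ ·) x.rep y.rep := by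
  rw [← mk_le_mk, mk_rep, mk_rep]

theorem mk_le_iff {A : Finset S} {y : LowerPt S} : mk A ≤ y ↔ lowerExt (· ≤ ·) A y.rep := by
  rw [← mk_le_mk, mk_rep]

theorem le_mk_iff {x : LowerPt S} {B : Finset S} : x ≤ mk B ↔ lowerExt (· ≤ ·) x.rep B := by
  rw [← mk_le_mk, mk_rep]

theorem forall_rep_mono {p : S → Prop} (hp : ∀ a b, a ≤ b → p b → p a) {x y : LowerPt S}
    (h : x ≤ y) (hy : ∀ b ∈ y.rep, p b) : ∀ a ∈ x.rep, p a := by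
  intro a ha
  obtain ⟨b, hb, hab⟩ := le_iff.1 h a ha
  exact hp a b hab (hy b hb)

theorem exists_rep_mono {p : S → Prop} (hp : ∀ a b, a ≤ b → p a → p b) {x y : LowerPt S}
    (h : x ≤ y) (hx : ∃ a ∈ x.rep, p a) : ∃ b ∈ y.rep, p b := by
  obtain ⟨a, ha, hpa⟩ := hx
  obtain ⟨b, hb, hab⟩ := le_iff.1 h a ha
  exact ⟨b, hb, hp a b hab hpa⟩

theorem forall_rep_mk {p : S → Prop} (hp : ∀ a b, a ≤ b → p b → p a) (A : Finset S) :
    (∀ a ∈ (mk A).rep, p a) ↔ ∀ a ∈ A, p a := by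
  constructor
  · intro h a ha
    obtain ⟨b, hb, hab⟩ := mk_le_iff.1 (le_refl (mk A)) a ha
    exact hp a b hab (h b hb)
  · intro h a ha
    obtain ⟨b, hb, hab⟩ := le_mk_iff.1 (le_refl (mk A)) a ha
    exact hp a b hab (h b hb)

theorem exists_rep_mk {p : S → Prop} (hp : ∀ a b, a ≤ b → p a → p b) (A : Finset S) :
    (∃ a ∈ (mk A).rep, p a) ↔ ∃ a ∈ A, p a := by
  constructor
  · rintro ⟨a, ha, hpa⟩
    obtain ⟨b, hb, hab⟩ := le_mk_iff.1 (le_refl (mk A)) a ha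
    exact ⟨b, hb, hp a b hab hpa⟩
  · rintro ⟨a, ha, hpa⟩
    obtain ⟨b, hb, hab⟩ := mk_le_iff.1 (le_refl (mk A)) a ha
    exact ⟨b, hb, hp a b hab hpa⟩

open Classical in
theorem isIdeal_forall {p : S → Prop} (hp : ∀ a b, a ≤ b → p b → p a) :
    Order.IsIdeal {x : LowerPt S | ∀ a ∈ x.rep, p a} where
  IsLowerSet _ _ h hy := forall_rep_mono hp h hy
  Nonempty := ⟨mk ∅, (forall_rep_mk hp ∅).2 (by simp)⟩
  Directed := by
    intro x hx y hy
    refine ⟨mk (x.rep ∪ y.rep), (forall_rep_mk hp _).2 ?_, le_mk_iff.2 ?_, le_mk_iff.2 ?_⟩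
    · intro a ha
      rcases Finset.mem_union.1 ha with ha | ha
      exacts [hx a ha, hy a ha]
    · exact fun a ha => ⟨a, Finset.mem_union_left _ ha, le_rfl⟩
    · exact fun a ha => ⟨a, Finset.mem_union_right _ ha, le_rfl⟩

end LowerPt

namespace UpperPt

/-- The class of a finite set. -/
def mk (A : Finset S) : UpperPt S := toAntisymmetrization (α := UpperFin S) (· ≤ ·) A

/-- A finite set that represents a given class. -/
noncomputable def rep (x : UpperPt S) : Finset S :=
  ofAntisymmetrization (α := UpperFin S) (· ≤ ·) x

theorem mk_rep (x : UpperPt S) : mk x.rep = x :=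
  toAntisymmetrization_ofAntisymmetrization (α := UpperFin S) (· ≤ ·) x

theorem mk_le_mk {A B : Finset S} : mk A ≤ mk B ↔ upperExt (· ≤ ·) A B := Iff.rfl

theorem le_iff {x y : UpperPt S} : x ≤ y ↔ upperExt (· ≤ ·) x.rep y.rep := by
  rw [← mk_le_mk, mk_rep, mk_rep]

theorem mk_le_iff {A : Finset S} {y : UpperPt S} : mk A ≤ y ↔ upperExt (· ≤ ·) A y.rep := by
  rw [← mk_le_mk, mk_rep]

theorem le_mk_iff {x : UpperPt S} {B : Finset S} : x ≤ mk B ↔ upperExt (· ≤ ·) x.rep B := by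
  rw [← mk_le_mk, mk_rep]

theorem forall_rep_mono {p : S → Prop} (hp : ∀ a b, a ≤ b → p a → p b) {x y : UpperPt S}
    (h : x ≤ y) (hx : ∀ a ∈ x.rep, p a) : ∀ b ∈ y.rep, p b := by
  intro b hb
  obtain ⟨a, ha, hab⟩ := le_iff.1 h b hb
  exact hp a b hab (hx a ha)

theorem exists_rep_mono {p : S → Prop} (hp : ∀ a b, a ≤ b → p b → p a) {x y : UpperPt S}
    (h : x ≤ y) (hy : ∃ b ∈ y.rep, p b) : ∃ a ∈ x.rep, p a := by
  obtain ⟨b, hb, hpb⟩ := hy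
  obtain ⟨a, ha, hab⟩ := le_iff.1 h b hb
  exact ⟨a, ha, hp a b hab hpb⟩

theorem forall_rep_mk {p : S → Prop} (hp : ∀ a b, a ≤ b → p a → p b) (A : Finset S) :
    (∀ a ∈ (mk A).rep, p a) ↔ ∀ a ∈ A, p a := by
  constructor
  · intro h a ha
    obtain ⟨b, hb, hab⟩ := le_mk_iff.1 (le_refl (mk A)) a ha
    exact hp b a hab (h b hb)
  · intro h a ha
    obtain ⟨b, hb, hab⟩ := mk_le_iff.1 (le_refl (mk A)) a ha
    exact hp b a hab (h b hb)

theorem exists_rep_mk {p : S → Prop} (hp : ∀ a b, a ≤ b → p b → p a) (A : Finset S) :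
    (∃ a ∈ (mk A).rep, p a) ↔ ∃ a ∈ A, p a := by
  constructor
  · rintro ⟨a, ha, hpa⟩
    obtain ⟨b, hb, hab⟩ := mk_le_iff.1 (le_refl (mk A)) a ha
    exact ⟨b, hb, hp b a hab hpa⟩
  · rintro ⟨a, ha, hpa⟩
    obtain ⟨b, hb, hab⟩ := le_mk_iff.1 (le_refl (mk A)) a ha
    exact ⟨b, hb, hp b a hab hpa⟩

open Classical in
theorem isIdeal_exists {γ : Type u} {p : S → γ → Prop} (hp : ∀ c, Order.IsIdeal {a | p a c})
    (C : Finset γ) : Order.IsIdeal {x : UpperPt S | ∀ c ∈ C, ∃ a ∈ x.rep, p a c} where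
  IsLowerSet _ _ h hy := fun c hc =>
    exists_rep_mono (fun _ _ hab hb => (hp c).IsLowerSet hab hb) h (hy c hc)
  Nonempty := by
    obtain ⟨A, hA, -⟩ := exists_finset_choice C (p := fun c a => p a c)
      (fun c _ => (hp c).Nonempty)
    exact ⟨mk A, fun c hc =>
      (exists_rep_mk (fun _ _ hab hb => (hp c).IsLowerSet hab hb) A).2 (hA c hc)⟩
  Directed := by
    intro x hx y hy
    have key : ∀ c ∈ C, ∃ d, p d c ∧ (∃ a ∈ x.rep, a ≤ d) ∧ ∃ b ∈ y.rep, b ≤ d := by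
      intro c hc
      obtain ⟨a, ha, hac⟩ := hx c hc
      obtain ⟨b, hb, hbc⟩ := hy c hc
      obtain ⟨d, hd, had, hbd⟩ := (hp c).Directed a hac b hbc
      exact ⟨d, hd, ⟨a, ha, had⟩, b, hb, hbd⟩
    obtain ⟨D, hD, hD'⟩ := exists_finset_choice C key
    refine ⟨mk D, ?_, le_mk_iff.2 ?_, le_mk_iff.2 ?_⟩
    · intro c hc
      obtain ⟨d, hd, hdc, -⟩ := hD c hc
      exact (exists_rep_mk (fun _ _ hab hb => (hp c).IsLowerSet hab hb) D).2 ⟨d, hd, hdc⟩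
    · intro d hd
      obtain ⟨c, -, -, h, -⟩ := hD' d hd
      exact h
    · intro d hd
      obtain ⟨c, -, -, -, h⟩ := hD' d hd
      exact h

end UpperPt

end

namespace PxPos

/-! ### The lower and upper powerlocales -/

section Builders

variable {S S' T : PxPos.{u}}

theorem exists_lowerPt_iff (r : Hom S S') {p : S' → Prop} (hp : ∀ a b, a ≤ b → p b → p a)
    (x : LowerPt S) :
    (∃ y : LowerPt S', lowerExt r.rel x.rep y.rep ∧ ∀ b ∈ y.rep, p b) ↔
      ∀ a ∈ x.rep, ∃ b, r.rel a b ∧ p b := by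
  constructor
  · rintro ⟨y, h1, h2⟩ a ha
    obtain ⟨b, hb, hab⟩ := h1 a ha
    exact ⟨b, hab, h2 b hb⟩
  · intro h
    obtain ⟨B, h1, h2⟩ := exists_finset_choice x.rep h
    refine ⟨LowerPt.mk B, fun a ha => ?_, (LowerPt.forall_rep_mk hp B).2 fun b hb => ?_⟩
    · refine (LowerPt.exists_rep_mk (fun _ _ h h' => r.le_right h' h) B).2 ?_
      obtain ⟨b, hb, hab, -⟩ := h1 a ha
      exact ⟨b, hb, hab⟩
    · obtain ⟨a, -, -, h⟩ := h2 b hb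
      exact h

theorem exists_upperPt_iff (r : Hom S S') {γ : Type u} {p : S' → γ → Prop}
    (hp : ∀ a b c, a ≤ b → p b c → p a c) (x : UpperPt S) (C : Finset γ) :
    (∃ y : UpperPt S', upperExt r.rel x.rep y.rep ∧ ∀ c ∈ C, ∃ b ∈ y.rep, p b c) ↔
      ∀ c ∈ C, ∃ a ∈ x.rep, ∃ b, r.rel a b ∧ p b c := by
  constructor
  · rintro ⟨y, h1, h2⟩ c hc
    obtain ⟨b, hb, hbc⟩ := h2 c hc
    obtain ⟨a, ha, hab⟩ := h1 b hb
    exact ⟨a, ha, b, hab, hbc⟩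
  · intro h
    have h' : ∀ c ∈ C, ∃ b, (∃ a ∈ x.rep, r.rel a b) ∧ p b c := by
      intro c hc
      obtain ⟨a, ha, b, hab, hbc⟩ := h c hc
      exact ⟨b, ⟨a, ha, hab⟩, hbc⟩
    obtain ⟨B, h1, h2⟩ := exists_finset_choice C h'
    refine ⟨UpperPt.mk B, ?_, fun c hc => ?_⟩
    · refine (UpperPt.forall_rep_mk (p := fun b => ∃ a ∈ x.rep, r.rel a b) ?_ B).2 fun b hb => ?_
      · rintro b b' hb ⟨a, ha, hab⟩
        exact ⟨a, ha, r.le_right hab hb⟩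
      · obtain ⟨c, -, h, -⟩ := h2 b hb
        exact h
    · refine (UpperPt.exists_rep_mk (fun a b => hp a b c) B).2 ?_
      obtain ⟨b, hb, -, hbc⟩ := h1 c hc
      exact ⟨b, hb, hbc⟩

end Builders

/-- The lower powerlocale of a proximity poset: the poset reflection of the finite subsets with the
lower extension of `≤`, and the lower extension of `≺`. (The choice of representatives does not
matter.) -/
@[reducible]
noncomputable def lowerObj (S : PxPos.{u}) : PxPos.{u} where
  carrier := LowerPt S
  prec x y := lowerExt S.prec x.rep y.rep
  approx :=
    { isIdeal := fun y => LowerPt.isIdeal_forall (p := fun a => ∃ b ∈ y.rep, S.prec a b)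
        (by rintro a a' h ⟨b, hb, hab⟩; exact ⟨b, hb, prec_le_left h hab⟩)
      isUpperSet := fun x y y' h hy a ha =>
        LowerPt.exists_rep_mono (fun _ _ h h' => prec_le_right h' h) h (hy a ha) }
  rounded x z := by
    refine Iff.trans ?_ (exists_lowerPt_iff (Hom.id S) (p := fun b => ∃ c ∈ z.rep, S.prec b c)
      ?_ x).symm
    · constructor
      · intro h a ha
        obtain ⟨c, hc, hac⟩ := h a ha
        obtain ⟨b, hab, hbc⟩ := (S.rounded a c).1 hac
        exact ⟨b, hab, c, hc, hbc⟩
      · intro h a ha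
        obtain ⟨b, hab, c, hc, hbc⟩ := h a ha
        exact ⟨c, hc, prec_trans hab hbc⟩
    · rintro a b h ⟨c, hc, hbc⟩
      exact ⟨c, hc, prec_le_left h hbc⟩

/-- The upper powerlocale of a proximity poset: the poset reflection of the finite subsets with the
upper extension of `≤`, and the upper extension of `≺`. (The choice of representatives does not
matter.) -/
@[reducible]
noncomputable def upperObj (S : PxPos.{u}) : PxPos.{u} where
  carrier := UpperPt S
  prec x y := upperExt S.prec x.rep y.rep
  approx :=
    { isIdeal := fun y => UpperPt.isIdeal_exists (p := S.prec) S.approx.isIdeal y.rep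
      isUpperSet := fun x y y' h hy =>
        UpperPt.forall_rep_mono (p := fun b => ∃ a ∈ x.rep, S.prec a b)
          (by rintro b b' h ⟨a, ha, hab⟩; exact ⟨a, ha, prec_le_right hab h⟩) h hy }
  rounded x z := by
    refine Iff.trans ?_ (exists_upperPt_iff (Hom.id S) (p := S.prec)
      (fun _ _ _ => prec_le_left) x z.rep).symm
    constructor
    · intro h c hc
      obtain ⟨a, ha, hac⟩ := h c hc
      exact ⟨a, ha, (S.rounded a c).1 hac⟩
    · intro h c hc
      obtain ⟨a, ha, hac⟩ := h c hc
      exact ⟨a, ha, (S.rounded a c).2 hac⟩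

section Builders2

variable {S S' T : PxPos.{u}}

/-- A tool to construct approximable relations out of a lower powerlocale. -/
def Hom.ofLower (rel : LowerPt S → T → Prop) (ρ : S → T → Prop)
    (h : ∀ x t, rel x t ↔ ∀ a ∈ x.rep, ρ a t)
    (h_left : ∀ a t, ρ a t ↔ ∃ a', S.prec a a' ∧ ρ a' t)
    (h_up : ∀ a t t', t ≤ t' → ρ a t → ρ a t')
    (h_right : ∀ a t t', ρ a t' → T.prec t' t → ρ a t)
    (h_right' : ∀ x : LowerPt S, ∀ t, (∀ a ∈ x.rep, ρ a t) →
      ∃ t', (∀ a ∈ x.rep, ρ a t') ∧ T.prec t' t) :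
    Hom (lowerObj S) T where
  rel := rel
  approx :=
    { isIdeal := fun t => by
        simp only [h]
        refine LowerPt.isIdeal_forall fun a b hab hb => ?_
        obtain ⟨c, hbc, hc⟩ := (h_left b t).1 hb
        exact (h_left a t).2 ⟨c, prec_le_left hab hbc, hc⟩
      isUpperSet := fun x t t' htt' hxt => by
        simp only [h, Set.mem_ofPred_eq] at hxt ⊢
        exact fun a ha => h_up a t t' htt' (hxt a ha) }
  rounded_left x t := by
    simp only [h]
    refine Iff.trans ?_ (exists_lowerPt_iff (Hom.id S) (p := fun a => ρ a t) ?_ x).symm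
    · exact ⟨fun h a ha => (h_left a t).1 (h a ha), fun h a ha => (h_left a t).2 (h a ha)⟩
    · intro a b hab hb
      obtain ⟨c, hbc, hc⟩ := (h_left b t).1 hb
      exact (h_left a t).2 ⟨c, prec_le_left hab hbc, hc⟩
  rounded_right x t := by
    simp only [h]
    exact ⟨h_right' x t, fun ⟨t', h1, h2⟩ a ha => h_right a t t' (h1 a ha) h2⟩

/-- A tool to construct approximable relations out of an upper powerlocale. -/
def Hom.ofUpper {γ : Type u} (rel : UpperPt S → T → Prop) (C : T → Finset γ) (ρ : S → γ → Prop)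
    (h : ∀ x t, rel x t ↔ ∀ c ∈ C t, ∃ a ∈ x.rep, ρ a c)
    (h_ideal : ∀ c, Order.IsIdeal {a | ρ a c})
    (h_left : ∀ a c, ρ a c ↔ ∃ a', S.prec a a' ∧ ρ a' c)
    (h_up : ∀ x t t', t ≤ t' → rel x t → rel x t')
    (h_right : ∀ x t, rel x t ↔ ∃ t', rel x t' ∧ T.prec t' t) :
    Hom (upperObj S) T where
  rel := rel
  approx :=
    { isIdeal := fun t => by
        simp only [h]
        exact UpperPt.isIdeal_exists h_ideal (C t)
      isUpperSet := fun x t t' htt' hxt => h_up x t t' htt' hxt }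
  rounded_left x t := by
    simp only [h]
    refine Iff.trans ?_ (exists_upperPt_iff (Hom.id S) (p := ρ)
      (fun a b c hab hb => (h_ideal c).IsLowerSet hab hb) x (C t)).symm
    constructor
    · intro h c hc
      obtain ⟨a, ha, hac⟩ := h c hc
      exact ⟨a, ha, (h_left a c).1 hac⟩
    · intro h c hc
      obtain ⟨a, ha, hac⟩ := h c hc
      exact ⟨a, ha, (h_left a c).2 hac⟩
  rounded_right := h_right

end Builders2

section Powerlocales

variable {S S' : PxPos.{u}}

/-- The lower powerlocale on morphisms: the lower extension. -/
noncomputable def lowerMap (r : S ⟶ S') : lowerObj S ⟶ lowerObj S' :=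
  Hom.ofLower (T := lowerObj S') (fun x y => lowerExt r.rel x.rep y.rep)
    (fun a y => ∃ b ∈ y.rep, r.rel a b) (fun _ _ => Iff.rfl)
    (fun a y => ⟨fun ⟨b, hb, hab⟩ =>
        let ⟨a', h, h'⟩ := (r.rounded_left a b).1 hab
        ⟨a', h, b, hb, h'⟩,
      fun ⟨_, h, b, hb, h'⟩ => ⟨b, hb, r.prec_left h h'⟩⟩)
    (fun _ _ _ h h' => LowerPt.exists_rep_mono (fun _ _ h h' => r.le_right h' h) h h')
    (fun _ _ _ ⟨b, hb, hab⟩ h =>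
      let ⟨c, hc, hbc⟩ := h b hb
      ⟨c, hc, r.prec_right hab hbc⟩)
    (fun x z h => by
      refine (exists_lowerPt_iff r (p := fun b => ∃ c ∈ z.rep, S'.prec b c) ?_ x).2 ?_
      · rintro a b h ⟨c, hc, hbc⟩
        exact ⟨c, hc, prec_le_left h hbc⟩
      · intro a ha
        obtain ⟨c, hc, hac⟩ := h a ha
        obtain ⟨b, hab, hbc⟩ := (r.rounded_right a c).1 hac
        exact ⟨b, hab, c, hc, hbc⟩)

/-- The upper powerlocale on morphisms: the upper extension. -/
noncomputable def upperMap (r : S ⟶ S') : upperObj S ⟶ upperObj S' :=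
  Hom.ofUpper (T := upperObj S') (fun x y => upperExt r.rel x.rep y.rep)
    (fun y => y.rep) r.rel (fun _ _ => Iff.rfl) r.approx.isIdeal r.rounded_left
    (fun x y y' h hy => UpperPt.forall_rep_mono (p := fun b => ∃ a ∈ x.rep, r.rel a b)
      (by rintro b b' h ⟨a, ha, hab⟩; exact ⟨a, ha, r.le_right hab h⟩) h hy)
    (fun x z => by
      refine Iff.trans ?_ (exists_upperPt_iff r (p := S'.prec)
        (fun _ _ _ => prec_le_left) x z.rep).symm
      constructor
      · intro h c hc
        obtain ⟨a, ha, hac⟩ := h c hc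
        exact ⟨a, ha, (r.rounded_right a c).1 hac⟩
      · intro h c hc
        obtain ⟨a, ha, hac⟩ := h c hc
        exact ⟨a, ha, (r.rounded_right a c).2 hac⟩)

theorem lowerMap_rel (r : S ⟶ S') (x : LowerPt S) (y : LowerPt S') :
    (lowerMap r).rel x y ↔ ∀ a ∈ x.rep, ∃ b ∈ y.rep, r.rel a b := Iff.rfl

theorem upperMap_rel (r : S ⟶ S') (x : UpperPt S) (y : UpperPt S') :
    (upperMap r).rel x y ↔ ∀ b ∈ y.rep, ∃ a ∈ x.rep, r.rel a b := Iff.rfl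

theorem lowerMap_comp_rel {T : PxPos.{u}} (r : S ⟶ S') (f : lowerObj S' ⟶ T) {p : S' → T → Prop}
    (hp : ∀ a b t, a ≤ b → p b t → p a t) (hf : ∀ x t, f.rel x t ↔ ∀ b ∈ x.rep, p b t)
    (x : LowerPt S) (t : T) :
    (lowerMap r ≫ f).rel x t ↔ ∀ a ∈ x.rep, ∃ b, r.rel a b ∧ p b t := by
  rw [comp_rel]
  simp only [hf]
  exact exists_lowerPt_iff r (fun a b => hp a b t) x

theorem upperMap_comp_rel {T : PxPos.{u}} {γ : Type u} (r : S ⟶ S') (f : upperObj S' ⟶ T)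
    {C : T → Finset γ} {p : S' → γ → Prop} (hp : ∀ a b c, a ≤ b → p b c → p a c)
    (hf : ∀ x t, f.rel x t ↔ ∀ c ∈ C t, ∃ b ∈ x.rep, p b c) (x : UpperPt S) (t : T) :
    (upperMap r ≫ f).rel x t ↔ ∀ c ∈ C t, ∃ a ∈ x.rep, ∃ b, r.rel a b ∧ p b c := by
  rw [comp_rel]
  simp only [hf]
  exact exists_upperPt_iff r hp x (C t)

/-- The lower powerlocale functor. -/
noncomputable def lowerFunctor : PxPos.{u} ⥤ PxPos.{u} where
  obj := lowerObj
  map := lowerMap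
  map_id _ := rfl
  map_comp {S S' S''} r s := by
    refine hom_ext fun x z => ?_
    refine Iff.trans ?_ (lowerMap_comp_rel r (lowerMap s)
      (p := fun b (z : LowerPt S'') => ∃ c ∈ z.rep, s.rel b c) ?_ (fun _ _ => Iff.rfl) x z).symm
    · constructor
      · intro h a ha
        obtain ⟨c, hc, b, hab, hbc⟩ := h a ha
        exact ⟨b, hab, c, hc, hbc⟩
      · intro h a ha
        obtain ⟨b, hab, c, hc, hbc⟩ := h a ha
        exact ⟨c, hc, b, hab, hbc⟩
    · rintro a b z h ⟨c, hc, hbc⟩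
      exact ⟨c, hc, s.le_left h hbc⟩

/-- The upper powerlocale functor. -/
noncomputable def upperFunctor : PxPos.{u} ⥤ PxPos.{u} where
  obj := upperObj
  map := upperMap
  map_id _ := rfl
  map_comp {S S' S''} r s := by
    refine hom_ext fun x z => ?_
    exact (upperMap_comp_rel r (upperMap s) (C := fun z : UpperPt S'' => z.rep)
      (p := s.rel) (fun _ _ _ => s.le_left) (fun _ _ => Iff.rfl) x z).symm

theorem exists_upper_bound {I : Set S} (hI : Order.IsIdeal I) (B : Finset S)
    (hB : ∀ b ∈ B, b ∈ I) : ∃ t ∈ I, ∀ b ∈ B, b ≤ t := by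
  classical
  induction B using Finset.induction_on with
  | empty =>
    obtain ⟨t, ht⟩ := hI.Nonempty
    exact ⟨t, ht, by simp⟩
  | insert b B _ ih =>
    obtain ⟨t, ht, htB⟩ := ih fun b' hb' => hB b' (Finset.mem_insert_of_mem hb')
    obtain ⟨t', ht', h1, h2⟩ := hI.Directed t ht b (hB b (Finset.mem_insert_self _ _))
    refine ⟨t', ht', fun b' hb' => ?_⟩
    rcases Finset.mem_insert.1 hb' with rfl | hb'
    exacts [h2, (htB b' hb').trans h1]

/-- The counit of the lower powerlocale: `A ε b` if and only if `A ≺_L {b}`. -/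
noncomputable def lowerCounit (S : PxPos.{u}) : lowerObj S ⟶ S :=
  Hom.ofLower (T := S) (fun x b => lowerExt S.prec x.rep {b}) S.prec
    (fun x b => by simp [lowerExt]) S.rounded (fun _ _ _ h h' => prec_le_right h' h)
    (fun _ _ _ => prec_trans)
    (fun x c h => by
      obtain ⟨B, h1, h2⟩ := exists_finset_choice x.rep
        (fun a ha => (S.rounded a c).1 (h a ha))
      obtain ⟨t, ht, htB⟩ := exists_upper_bound (S.approx.isIdeal c) B
        fun b hb => (h2 b hb).choose_spec.2.2
      refine ⟨t, fun a ha => ?_, ht⟩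
      obtain ⟨b, hb, hab, -⟩ := h1 a ha
      exact prec_le_right hab (htB b hb))

theorem lowerCounit_rel (x : LowerPt S) (b : S) :
    (lowerCounit S).rel x b ↔ ∀ a ∈ x.rep, S.prec a b := by
  simp [lowerCounit, Hom.ofLower, lowerExt]

/-- The counit of the upper powerlocale: `A ε b` if and only if `A ≺_U {b}`. -/
noncomputable def upperCounit (S : PxPos.{u}) : upperObj S ⟶ S :=
  Hom.ofUpper (T := S) (fun x b => upperExt S.prec x.rep {b}) (fun b => {b}) S.prec
    (fun x b => Iff.rfl) S.approx.isIdeal S.rounded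
    (fun x b b' h => by
      simp only [upperExt, Finset.mem_singleton, forall_eq]
      rintro ⟨a, ha, hab⟩
      exact ⟨a, ha, prec_le_right hab h⟩)
    (fun x c => by
      simp only [upperExt, Finset.mem_singleton, forall_eq]
      constructor
      · rintro ⟨a, ha, hac⟩
        obtain ⟨b, hab, hbc⟩ := (S.rounded a c).1 hac
        exact ⟨b, ⟨a, ha, hab⟩, hbc⟩
      · rintro ⟨b, ⟨a, ha, hab⟩, hbc⟩
        exact ⟨a, ha, prec_trans hab hbc⟩)

theorem upperCounit_rel (x : UpperPt S) (b : S) :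
    (upperCounit S).rel x b ↔ ∃ a ∈ x.rep, S.prec a b := by
  simp [upperCounit, Hom.ofUpper, upperExt]

/-- The relation `a ≺ b` for some `b ∈ ⋃ 𝒰`. -/
def belowUnion (S : PxPos.{u}) (a : S) (U : LowerPt (lowerObj S)) : Prop :=
  ∃ y ∈ U.rep, ∃ b ∈ LowerPt.rep y, S.prec a b

theorem belowUnion_mono {a : S} {U V : LowerPt (lowerObj S)} (h : U ≤ V)
    (hU : belowUnion S a U) : belowUnion S a V :=
  LowerPt.exists_rep_mono (S := lowerObj S)
    (fun _ _ h h' => LowerPt.exists_rep_mono (fun _ _ h h' => prec_le_right h' h) h h') h hU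

theorem belowUnion_mk {a : S} {A : Finset (lowerObj S)} :
    belowUnion S a (LowerPt.mk A) ↔ ∃ y ∈ A, ∃ b ∈ LowerPt.rep y, S.prec a b :=
  LowerPt.exists_rep_mk (S := lowerObj S)
    (fun _ _ h h' => LowerPt.exists_rep_mono (fun _ _ h h' => prec_le_right h' h) h h') A

theorem exists_rep_singleton {a b : S} :
    (∃ b' ∈ (LowerPt.mk {b}).rep, S.prec a b') ↔ S.prec a b := by
  rw [LowerPt.exists_rep_mk (fun _ _ h h' => prec_le_right h' h)]
  simp

open Classical in
/-- The union `⋃ 𝒰` of a finite family of finite sets (formed with representatives). -/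
noncomputable def lowerUnion (U : LowerPt (lowerObj S)) : Finset S :=
  (LowerPt.rep U).biUnion LowerPt.rep

open Classical in
/-- The union `⋃ 𝒰` of a finite family of finite sets (formed with representatives). -/
noncomputable def upperUnion (U : UpperPt (upperObj S)) : Finset S :=
  (UpperPt.rep U).biUnion UpperPt.rep

theorem mem_lowerUnion {U : LowerPt (lowerObj S)} {b : S} :
    b ∈ lowerUnion U ↔ ∃ y ∈ LowerPt.rep U, b ∈ LowerPt.rep y := by
  classical
  simp [lowerUnion]

theorem mem_upperUnion {U : UpperPt (upperObj S)} {b : S} :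
    b ∈ upperUnion U ↔ ∃ y ∈ UpperPt.rep U, b ∈ UpperPt.rep y := by
  classical
  simp [upperUnion]

theorem lowerExt_lowerUnion {x : LowerPt S} {U : LowerPt (lowerObj S)} :
    lowerExt S.prec x.rep (lowerUnion U) ↔ ∀ a ∈ x.rep, belowUnion S a U := by
  refine forall₂_congr fun a _ => ?_
  simp only [belowUnion, mem_lowerUnion]
  exact ⟨fun ⟨b, ⟨y, hy, hb⟩, h⟩ => ⟨y, hy, b, hb, h⟩,
    fun ⟨y, hy, b, hb, h⟩ => ⟨b, ⟨y, hy, hb⟩, h⟩⟩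

theorem upperExt_upperUnion {x : UpperPt S} {U : UpperPt (upperObj S)} :
    upperExt S.prec x.rep (upperUnion U) ↔ ∀ y ∈ U.rep, (upperObj S).prec x y := by
  simp only [upperExt, mem_upperUnion]
  exact ⟨fun h y hy b hb => h b ⟨y, hy, hb⟩, fun h b ⟨y, hy, hb⟩ => h y hy b hb⟩

open Classical in
/-- The comultiplication of the lower powerlocale: `A ν 𝒰` if and only if `A ≺_L ⋃ 𝒰`. -/
noncomputable def lowerComult (S : PxPos.{u}) : lowerObj S ⟶ lowerObj (lowerObj S) :=
  Hom.ofLower (T := lowerObj (lowerObj S))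
    (fun x U => lowerExt S.prec x.rep (lowerUnion U)) (belowUnion S)
    (fun _ _ => lowerExt_lowerUnion)
    (fun a U => by
      constructor
      · rintro ⟨y, hy, b, hb, hab⟩
        obtain ⟨a', h, h'⟩ := (S.rounded a b).1 hab
        exact ⟨a', h, y, hy, b, hb, h'⟩
      · rintro ⟨a', h, y, hy, b, hb, h'⟩
        exact ⟨y, hy, b, hb, prec_trans h h'⟩)
    (fun a U V h => belowUnion_mono h)
    (by
      rintro a U V ⟨y, hy, b, hb, hab⟩ hVU
      obtain ⟨z, hz, hyz⟩ := hVU y hy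
      obtain ⟨c, hc, hbc⟩ := hyz b hb
      exact ⟨z, hz, c, hc, prec_trans hab hbc⟩)
    (fun x U h => by
      have h' : ∀ a ∈ x.rep, ∃ b, S.prec a b ∧ belowUnion S b U := by
        intro a ha
        obtain ⟨y, hy, c, hc, hac⟩ := h a ha
        obtain ⟨b, hab, hbc⟩ := (S.rounded a c).1 hac
        exact ⟨b, hab, y, hy, c, hc, hbc⟩
      obtain ⟨B, h1, h2⟩ := exists_finset_choice x.rep h'
      refine ⟨LowerPt.mk (S := lowerObj S) (B.image fun b => LowerPt.mk {b}), fun a ha => ?_, ?_⟩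
      · rw [belowUnion_mk]
        obtain ⟨b, hb, hab, -⟩ := h1 a ha
        exact ⟨LowerPt.mk {b}, Finset.mem_image_of_mem _ hb, exists_rep_singleton.2 hab⟩
      · refine (LowerPt.forall_rep_mk (S := lowerObj S)
          (p := fun y => ∃ z ∈ LowerPt.rep (S := lowerObj S) U, (lowerObj S).prec y z) ?_ _).2 ?_
        · rintro y y' h ⟨z, hz, hyz⟩
          exact ⟨z, hz, prec_le_left h hyz⟩
        · intro y hy
          obtain ⟨b, hb, rfl⟩ := Finset.mem_image.1 hy
          obtain ⟨a, -, -, z, hz, c, hc, hbc⟩ := h2 b hb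
          refine ⟨z, hz, (LowerPt.forall_rep_mk (p := fun b => ∃ c ∈ LowerPt.rep z, S.prec b c)
            ?_ _).2 ?_⟩
          · rintro b b' h ⟨c, hc, hbc⟩
            exact ⟨c, hc, prec_le_left h hbc⟩
          · intro b' hb'
            rw [Finset.mem_singleton.1 hb']
            exact ⟨c, hc, hbc⟩)

theorem lowerComult_rel (x : LowerPt S) (U : LowerPt (lowerObj S)) :
    (lowerComult S).rel x U ↔ ∀ a ∈ x.rep, belowUnion S a U :=
  lowerExt_lowerUnion

/-- The comultiplication of the upper powerlocale: `A ν 𝒰` if and only if `A ≺_U ⋃ 𝒰`. -/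
noncomputable def upperComult (S : PxPos.{u}) : upperObj S ⟶ upperObj (upperObj S) :=
  Hom.ofUpper (T := upperObj (upperObj S))
    (fun x U => upperExt S.prec x.rep (upperUnion U)) upperUnion
    S.prec (fun _ _ => Iff.rfl) S.approx.isIdeal S.rounded
    (fun x U V h hU => by
      rw [upperExt_upperUnion] at hU ⊢
      exact UpperPt.forall_rep_mono (S := upperObj S) (fun _ _ h h' => prec_le_right h' h) h hU)
    (fun x U => by
      simp only [upperExt_upperUnion]
      constructor
      · intro h
        obtain ⟨Y, h1, h2⟩ := exists_finset_choice U.rep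
          fun y hy => ((upperObj S).rounded x y).1 (h y hy)
        refine ⟨UpperPt.mk (S := upperObj S) Y, ?_, ?_⟩
        · refine (UpperPt.forall_rep_mk (S := upperObj S)
            (fun _ _ h h' => prec_le_right h' h) Y).2 fun y hy => ?_
          obtain ⟨z, -, h, -⟩ := h2 y hy
          exact h
        · intro z hz
          refine (UpperPt.exists_rep_mk (S := upperObj S) (fun _ _ h h' => prec_le_left (S := upperObj S) h h') Y).2 ?_
          obtain ⟨y, hy, -, h⟩ := h1 z hz
          exact ⟨y, hy, h⟩
      · rintro ⟨V, h1, h2⟩ z hz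
        obtain ⟨y, hy, hyz⟩ := h2 z hz
        exact prec_trans (S := upperObj S) (h1 y hy) hyz)

theorem upperComult_rel (x : UpperPt S) (U : UpperPt (upperObj S)) :
    (upperComult S).rel x U ↔ ∀ y ∈ U.rep, (upperObj S).prec x y :=
  upperExt_upperUnion

end Powerlocales

section Laws

variable {S S' T : PxPos.{u}}

theorem forall_rep_singleton {p : S → Prop} (hp : ∀ a b, a ≤ b → p b → p a) (a : S) :
    (∀ b ∈ (LowerPt.mk {a}).rep, p b) ↔ p a := by
  rw [LowerPt.forall_rep_mk hp]
  simp

theorem lowerMap_rel_singleton (f : S ⟶ S') (a : S) (y : LowerPt S') :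
    (lowerMap f).rel (LowerPt.mk {a}) y ↔ ∃ b ∈ y.rep, f.rel a b :=
  forall_rep_singleton (p := fun a => ∃ b ∈ y.rep, f.rel a b)
    (by rintro a a' h ⟨b, hb, hab⟩; exact ⟨b, hb, f.le_left h hab⟩) a

theorem lower_prec_singleton (a : S) (y : LowerPt S) :
    (lowerObj S).prec (LowerPt.mk {a}) y ↔ ∃ b ∈ y.rep, S.prec a b :=
  lowerMap_rel_singleton (𝟙 S) a y

theorem lowerComult_rel_singleton (a : S) (U : LowerPt (lowerObj S)) :
    (lowerComult S).rel (LowerPt.mk {a}) U ↔ belowUnion S a U := by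
  rw [lowerComult_rel]
  refine forall_rep_singleton (p := fun a => belowUnion S a U) ?_ a
  rintro a a' h ⟨y, hy, b, hb, hab⟩
  exact ⟨y, hy, b, hb, prec_le_left h hab⟩

theorem lowerCounit_rel_singleton (a b : S) :
    (lowerCounit S).rel (LowerPt.mk {a}) b ↔ S.prec a b := by
  rw [lowerCounit_rel]
  exact forall_rep_singleton (fun _ _ h h' => prec_le_left h h') a

theorem lowerCounit_comp_rel (f : S ⟶ T) (x : LowerPt S) (t : T) :
    (lowerCounit S ≫ f).rel x t ↔ ∀ a ∈ x.rep, f.rel a t := by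
  rw [comp_rel]
  simp only [lowerCounit_rel]
  constructor
  · rintro ⟨b, h1, h2⟩ a ha
    exact f.prec_left (h1 a ha) h2
  · intro h
    obtain ⟨B, h1, h2⟩ := exists_finset_choice x.rep fun a ha => (f.rounded_left a t).1 (h a ha)
    obtain ⟨b, hb, hB⟩ := exists_upper_bound (f.approx.isIdeal t) B
      fun b hb => (h2 b hb).choose_spec.2.2
    refine ⟨b, fun a ha => ?_, hb⟩
    obtain ⟨c, hc, hac, -⟩ := h1 a ha
    exact prec_le_right hac (hB c hc)

theorem lowerComult_comp_rel (f : lowerObj (lowerObj S) ⟶ T) {p : LowerPt S → T → Prop}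
    (hp : ∀ a b t, a ≤ b → p b t → p a t) (hf : ∀ U t, f.rel U t ↔ ∀ y ∈ LowerPt.rep U, p y t)
    (x : LowerPt S) (t : T) :
    (lowerComult S ≫ f).rel x t ↔ ∀ a ∈ x.rep, ∃ a', S.prec a a' ∧ p (LowerPt.mk {a'}) t := by
  classical
  rw [comp_rel]
  simp only [lowerComult_rel, hf]
  constructor
  · rintro ⟨U, h1, h2⟩ a ha
    obtain ⟨y, hy, b, hb, hab⟩ := h1 a ha
    refine ⟨b, hab, hp _ y t ?_ (h2 y hy)⟩
    rw [LowerPt.mk_le_iff]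
    intro b' hb'
    rw [Finset.mem_singleton.1 hb']
    exact ⟨b, hb, le_rfl⟩
  · intro h
    obtain ⟨B, h1, h2⟩ := exists_finset_choice x.rep h
    refine ⟨LowerPt.mk (S := lowerObj S) (B.image fun b => LowerPt.mk {b}), fun a ha => ?_, ?_⟩
    · rw [belowUnion_mk]
      obtain ⟨b, hb, hab, -⟩ := h1 a ha
      exact ⟨LowerPt.mk {b}, Finset.mem_image_of_mem _ hb, exists_rep_singleton.2 hab⟩
    · refine (LowerPt.forall_rep_mk (S := lowerObj S) (fun a b => hp a b t) _).2 ?_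
      intro y hy
      obtain ⟨b, hb, rfl⟩ := Finset.mem_image.1 hy
      obtain ⟨a, -, -, h⟩ := h2 b hb
      exact h

/-- The lower powerlocale comonad. -/
noncomputable def lowerPowerlocale : Comonad PxPos.{u} where
  toFunctor := lowerFunctor
  ε :=
    { app := lowerCounit
      naturality := by
        intro S S' f
        refine hom_ext fun x t => ?_
        refine (lowerMap_comp_rel f (lowerCounit S') (p := S'.prec)
          (fun _ _ _ => prec_le_left) lowerCounit_rel x t).trans ?_
        refine Iff.trans ?_ (lowerCounit_comp_rel f x t).symm
        exact forall₂_congr fun a _ => (f.rounded_right a t).symm }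
  δ :=
    { app := lowerComult
      naturality := by
        intro S S' f
        refine hom_ext fun x U => ?_
        refine (lowerMap_comp_rel f (lowerComult S') (p := belowUnion S') ?_
          lowerComult_rel x U).trans ?_
        · rintro a b U h ⟨y, hy, c, hc, hbc⟩
          exact ⟨y, hy, c, hc, prec_le_left h hbc⟩
        refine Iff.trans ?_ (lowerComult_comp_rel (lowerMap (lowerMap f))
          (p := fun y U => ∃ z ∈ LowerPt.rep U, (lowerMap f).rel y z) ?_
          (fun _ _ => Iff.rfl) x U).symm
        · refine forall₂_congr fun a _ => ?_
          simp only [lowerMap_rel_singleton]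
          constructor
          · rintro ⟨b, hab, z, hz, c, hc, hbc⟩
            obtain ⟨a', h, h'⟩ := (f.rounded_left a b).1 hab
            exact ⟨a', h, z, hz, c, hc, f.prec_right h' hbc⟩
          · rintro ⟨a', h, z, hz, c, hc, hac⟩
            obtain ⟨b, h1, h2⟩ := (f.rounded_right a' c).1 hac
            exact ⟨b, f.prec_left h h1, z, hz, c, hc, h2⟩
        · rintro y y' U h ⟨z, hz, hyz⟩
          exact ⟨z, hz, (lowerMap f).le_left h hyz⟩ }
  coassoc := by
    intro S
    refine hom_ext fun x W => ?_
    refine (lowerComult_comp_rel (lowerMap (lowerComult S))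
      (p := fun y W => ∃ V ∈ LowerPt.rep W, (lowerComult S).rel y V) ?_
      (fun _ _ => Iff.rfl) x W).trans ?_
    · rintro y y' W h ⟨V, hV, hyV⟩
      exact ⟨V, hV, (lowerComult S).le_left h hyV⟩
    refine Iff.trans ?_ (lowerComult_comp_rel (lowerComult (lowerObj S))
      (p := belowUnion (lowerObj S)) ?_ lowerComult_rel x W).symm
    · refine forall₂_congr fun a _ => exists_congr fun a' => and_congr_right fun _ => ?_
      refine exists_congr fun V => and_congr_right fun _ => ?_
      refine (lowerComult_rel_singleton a' V).trans ?_
      exact exists_congr fun z => and_congr_right fun _ => (lower_prec_singleton a' z).symm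
    · rintro y y' W h ⟨V, hV, z, hz, hyz⟩
      exact ⟨V, hV, z, hz, prec_le_left (S := lowerObj S) h hyz⟩
  left_counit := by
    intro S
    refine hom_ext fun x y => ?_
    refine (lowerComult_comp_rel (lowerCounit (lowerObj S)) (p := (lowerObj S).prec)
      (fun _ _ _ => prec_le_left (S := lowerObj S)) lowerCounit_rel x y).trans ?_
    refine forall₂_congr fun a _ => ?_
    refine (exists_congr fun a' => and_congr_right fun _ => lower_prec_singleton a' y).trans ?_
    constructor
    · rintro ⟨a', h, b, hb, hab⟩
      exact ⟨b, hb, prec_trans h hab⟩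
    · rintro ⟨b, hb, hab⟩
      obtain ⟨a', h, h'⟩ := (S.rounded a b).1 hab
      exact ⟨a', h, b, hb, h'⟩
  right_counit := by
    intro S
    refine hom_ext fun x y => ?_
    refine (lowerComult_comp_rel (lowerMap (lowerCounit S))
      (p := fun y z => ∃ b ∈ LowerPt.rep z, (lowerCounit S).rel y b) ?_
      (fun _ _ => Iff.rfl) x y).trans ?_
    · rintro y y' z h ⟨b, hb, hyb⟩
      exact ⟨b, hb, (lowerCounit S).le_left h hyb⟩
    refine forall₂_congr fun a _ => ?_
    simp only [lowerCounit_rel_singleton]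
    constructor
    · rintro ⟨a', h, b, hb, hab⟩
      exact ⟨b, hb, prec_trans h hab⟩
    · rintro ⟨b, hb, hab⟩
      obtain ⟨a', h, h'⟩ := (S.rounded a b).1 hab
      exact ⟨a', h, b, hb, h'⟩

theorem upperCounit_comp_rel (f : S ⟶ T) (x : UpperPt S) (t : T) :
    (upperCounit S ≫ f).rel x t ↔ ∃ a ∈ x.rep, f.rel a t := by
  rw [comp_rel]
  simp only [upperCounit_rel]
  constructor
  · rintro ⟨b, ⟨a, ha, hab⟩, h⟩
    exact ⟨a, ha, f.prec_left hab h⟩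
  · rintro ⟨a, ha, hat⟩
    obtain ⟨b, hab, hbt⟩ := (f.rounded_left a t).1 hat
    exact ⟨b, ⟨a, ha, hab⟩, hbt⟩

theorem upperComult_comp_rel {γ : Type u} (f : upperObj (upperObj S) ⟶ T) {C : T → Finset γ}
    {p : UpperPt S → γ → Prop} (hp : ∀ a b c, a ≤ b → p b c → p a c)
    (hf : ∀ U t, f.rel U t ↔ ∀ c ∈ C t, ∃ y ∈ UpperPt.rep U, p y c)
    (x : UpperPt S) (t : T) :
    (upperComult S ≫ f).rel x t ↔ ∀ c ∈ C t, ∃ y, (upperObj S).prec x y ∧ p y c := by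
  rw [comp_rel]
  simp only [upperComult_rel, hf]
  constructor
  · rintro ⟨U, h1, h2⟩ c hc
    obtain ⟨y, hy, hyc⟩ := h2 c hc
    exact ⟨y, h1 y hy, hyc⟩
  · intro h
    obtain ⟨Y, h1, h2⟩ := exists_finset_choice (C t) h
    refine ⟨UpperPt.mk (S := upperObj S) Y, ?_, fun c hc => ?_⟩
    · refine (UpperPt.forall_rep_mk (S := upperObj S)
        (fun _ _ h h' => prec_le_right h' h) Y).2 fun y hy => ?_
      obtain ⟨c, -, h, -⟩ := h2 y hy
      exact h
    · refine (UpperPt.exists_rep_mk (S := upperObj S) (fun a b => hp a b c) Y).2 ?_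
      obtain ⟨y, hy, -, h⟩ := h1 c hc
      exact ⟨y, hy, h⟩

/-- The upper powerlocale comonad. -/
noncomputable def upperPowerlocale : Comonad PxPos.{u} where
  toFunctor := upperFunctor
  ε :=
    { app := upperCounit
      naturality := by
        intro S S' f
        refine hom_ext fun x t => ?_
        refine (upperMap_comp_rel f (upperCounit S') (C := fun t => {t}) (p := S'.prec)
          (fun _ _ _ => prec_le_left) (fun x t => by simp [upperCounit_rel]) x t).trans ?_
        refine Iff.trans ?_ (upperCounit_comp_rel f x t).symm
        simp only [Finset.mem_singleton, forall_eq]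
        exact exists_congr fun a => and_congr_right fun _ => (f.rounded_right a t).symm }
  δ :=
    { app := upperComult
      naturality := by
        intro S S' f
        refine hom_ext fun x U => ?_
        refine Iff.trans ?_ (upperComult_comp_rel (upperMap (upperMap f))
          (C := fun U => UpperPt.rep U) (p := (upperMap f).rel)
          (fun _ _ _ => (upperMap f).le_left) (fun _ _ => Iff.rfl) x U).symm
        refine Iff.trans ?_ (forall₂_congr fun z _ => (upperMap f).rounded_left x z)
        refine (upperMap_comp_rel f (upperComult S') (C := upperUnion) (p := S'.prec)
          (fun _ _ _ => prec_le_left) (fun _ _ => Iff.rfl) x U).trans ?_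
        constructor
        · intro h z hz b hb
          obtain ⟨a, ha, c, hac, hcb⟩ := h b (mem_upperUnion.2 ⟨z, hz, hb⟩)
          exact ⟨a, ha, f.prec_right hac hcb⟩
        · intro h b hb
          obtain ⟨z, hz, hb⟩ := mem_upperUnion.1 hb
          obtain ⟨a, ha, hab⟩ := h z hz b hb
          exact ⟨a, ha, (f.rounded_right a b).1 hab⟩ }
  coassoc := by
    intro S
    refine hom_ext fun x W => ?_
    refine (upperComult_comp_rel (upperMap (upperComult S))
      (C := fun W => UpperPt.rep W) (p := (upperComult S).rel)
      (fun _ _ _ => (upperComult S).le_left) (fun _ _ => Iff.rfl) x W).trans ?_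
    refine Iff.trans (forall₂_congr fun V _ => ((upperComult S).rounded_left x V).symm) ?_
    refine Iff.trans ?_ (upperComult_comp_rel (upperComult (upperObj S))
      (C := upperUnion) (p := (upperObj S).prec)
      (fun _ _ _ => prec_le_left (S := upperObj S)) (fun _ _ => Iff.rfl) x W).symm
    constructor
    · intro h z hz
      obtain ⟨V, hV, hz⟩ := mem_upperUnion.1 hz
      exact ((upperObj S).rounded x z).1 ((upperComult_rel x V).1 (h V hV) z hz)
    · intro h V hV
      refine (upperComult_rel x V).2 fun z hz => ?_
      exact ((upperObj S).rounded x z).2 (h z (mem_upperUnion.2 ⟨V, hV, hz⟩))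
  left_counit := by
    intro S
    refine hom_ext fun x z => ?_
    refine (upperComult_comp_rel (upperCounit (upperObj S)) (C := fun z => {z})
      (p := (upperObj S).prec) (fun _ _ _ => prec_le_left (S := upperObj S))
      (fun _ _ => Iff.rfl) x z).trans ?_
    refine Iff.trans ⟨fun h => h z (Finset.mem_singleton_self z), fun h c hc => ?_⟩
      ((upperObj S).rounded x z).symm
    rw [Finset.mem_singleton.1 hc]
    exact h
  right_counit := by
    intro S
    refine hom_ext fun x z => ?_
    refine (upperComult_comp_rel (upperMap (upperCounit S))
      (C := fun z => UpperPt.rep z) (p := (upperCounit S).rel)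
      (fun _ _ _ => (upperCounit S).le_left) (fun _ _ => Iff.rfl) x z).trans ?_
    refine Iff.trans (forall₂_congr fun b _ => ((upperCounit S).rounded_left x b).symm) ?_
    exact forall₂_congr fun b _ => upperCounit_rel x b

/-! ### The distributive law and the double powerlocale -/

open Classical in
/-- The finite family `𝒱^*` for an element `𝒱` of the lower powerlocale of the upper
powerlocale. -/
noncomputable def starU (y : LowerPt (upperObj S)) : Finset (Finset S) :=
  finsetStar ((LowerPt.rep y).image UpperPt.rep)

open Classical in
/-- The finite family `𝒰^*` for an element `𝒰` of the upper powerlocale of the lower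
powerlocale. -/
noncomputable def starL (x : UpperPt (lowerObj S)) : Finset (Finset S) :=
  finsetStar ((UpperPt.rep x).image LowerPt.rep)

theorem starU_meets {y : LowerPt (upperObj S)} {B : Finset S} (hB : B ∈ starU y)
    {V : UpperPt S} (hV : V ∈ LowerPt.rep y) : ∃ v ∈ V.rep, v ∈ B := by
  classical
  exact finsetStar_meets hB (Finset.mem_image_of_mem _ hV)

theorem starL_meets {x : UpperPt (lowerObj S)} {X : Finset S} (hX : X ∈ starL x)
    {A : LowerPt S} (hA : A ∈ UpperPt.rep x) : ∃ a ∈ A.rep, a ∈ X := by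
  classical
  exact finsetStar_meets hX (Finset.mem_image_of_mem _ hA)

theorem exists_starU_or (y : LowerPt (upperObj S)) (p : S → Prop) :
    (∃ B ∈ starU y, ∀ b ∈ B, p b) ∨ ∃ V ∈ LowerPt.rep y, ∀ v ∈ V.rep, ¬ p v := by
  classical
  rcases exists_mem_finsetStar_or ((LowerPt.rep y).image UpperPt.rep) p with h | ⟨A, hA, h⟩
  · exact Or.inl h
  · obtain ⟨V, hV, rfl⟩ := Finset.mem_image.1 hA
    exact Or.inr ⟨V, hV, h⟩

theorem exists_starL_or (x : UpperPt (lowerObj S)) (p : S → Prop) :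
    (∃ X ∈ starL x, ∀ a ∈ X, p a) ∨ ∃ A ∈ UpperPt.rep x, ∀ a ∈ A.rep, ¬ p a := by
  classical
  rcases exists_mem_finsetStar_or ((UpperPt.rep x).image LowerPt.rep) p with h | ⟨A, hA, h⟩
  · exact Or.inl h
  · obtain ⟨V, hV, rfl⟩ := Finset.mem_image.1 hA
    exact Or.inr ⟨V, hV, h⟩

theorem star_duality (r : S → S' → Prop) (x : UpperPt (lowerObj S)) (y : LowerPt (upperObj S')) :
    (∀ B ∈ starU y, ∃ A ∈ UpperPt.rep x, lowerExt r A.rep B) ↔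
      ∀ X ∈ starL x, ∃ V ∈ LowerPt.rep y, upperExt r X V.rep := by
  classical
  have h := finsetStar_duality r ((UpperPt.rep x).image LowerPt.rep)
    ((LowerPt.rep y).image UpperPt.rep)
  simpa only [Finset.mem_image, exists_exists_and_eq_and, starU, starL] using h

theorem exists_lowerPt_iff_of_finset {γ : Type u} (F : Finset γ) {q : γ → T → Prop} {p : T → Prop}
    (hq : ∀ c a b, a ≤ b → q c a → q c b) (hp : ∀ a b, a ≤ b → p b → p a) :
    (∃ y : LowerPt T, (∀ c ∈ F, ∃ b ∈ y.rep, q c b) ∧ ∀ b ∈ y.rep, p b) ↔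
      ∀ c ∈ F, ∃ b, q c b ∧ p b := by
  constructor
  · rintro ⟨y, h1, h2⟩ c hc
    obtain ⟨b, hb, hcb⟩ := h1 c hc
    exact ⟨b, hcb, h2 b hb⟩
  · intro h
    obtain ⟨B, h1, h2⟩ := exists_finset_choice F h
    refine ⟨LowerPt.mk B, fun c hc => ?_, (LowerPt.forall_rep_mk hp B).2 fun b hb => ?_⟩
    · refine (LowerPt.exists_rep_mk (hq c) B).2 ?_
      obtain ⟨b, hb, hcb, -⟩ := h1 c hc
      exact ⟨b, hb, hcb⟩
    · obtain ⟨c, -, -, h⟩ := h2 b hb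
      exact h

theorem upperMap_mk_rel (f : S ⟶ S') (X : Finset S) (V : UpperPt S') :
    (upperMap f).rel (UpperPt.mk X) V ↔ upperExt f.rel X V.rep :=
  forall₂_congr fun _ _ => UpperPt.exists_rep_mk (fun _ _ h h' => f.le_left h h') X

theorem upper_prec_mk (X : Finset S) (V : UpperPt S) :
    (upperObj S).prec (UpperPt.mk X) V ↔ upperExt S.prec X V.rep :=
  upperMap_mk_rel (𝟙 S) X V

theorem lowerMap_rel_mk (f : S ⟶ S') (A : LowerPt S) (B : Finset S') :
    (lowerMap f).rel A (LowerPt.mk B) ↔ lowerExt f.rel A.rep B :=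
  forall₂_congr fun _ _ => LowerPt.exists_rep_mk (fun _ _ h h' => f.le_right h' h) B

theorem lower_prec_mk (A : LowerPt S) (B : Finset S) :
    (lowerObj S).prec A (LowerPt.mk B) ↔ lowerExt S.prec A.rep B :=
  lowerMap_rel_mk (𝟙 S) A B

/-- On classes of finite sets, the relation of the lower powerlocale is the lower extension. -/
theorem lower_prec_mk_mk (A B : Finset S) :
    (lowerObj S).prec (LowerPt.mk A) (LowerPt.mk B) ↔ lowerExt S.prec A B := by
  refine (lower_prec_mk _ B).trans (LowerPt.forall_rep_mk (p := fun a => ∃ b ∈ B, S.prec a b) ?_ A)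
  rintro a a' h ⟨b, hb, hab⟩
  exact ⟨b, hb, prec_le_left h hab⟩

/-- On classes of finite sets, the relation of the upper powerlocale is the upper extension. -/
theorem upper_prec_mk_mk (A B : Finset S) :
    (upperObj S).prec (UpperPt.mk A) (UpperPt.mk B) ↔ upperExt S.prec A B := by
  refine (upper_prec_mk A _).trans (UpperPt.forall_rep_mk (p := fun b => ∃ a ∈ A, S.prec a b) ?_ B)
  rintro b b' h ⟨a, ha, hab⟩
  exact ⟨a, ha, prec_le_right hab h⟩

theorem upperExt_prec_mono {X : Finset S} {V V' : UpperPt S} (h : V ≤ V')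
    (hV : upperExt S.prec X V.rep) : upperExt S.prec X V'.rep :=
  (upper_prec_mk X V').1 (prec_le_right (S := upperObj S) ((upper_prec_mk X V).2 hV) h)

theorem sigma_dual (x : UpperPt (lowerObj S)) (y : LowerPt (upperObj S)) :
    (∀ B ∈ starU y, ∃ A ∈ UpperPt.rep x, lowerExt S.prec A.rep B) ↔
      ∀ X ∈ starL x, ∃ V ∈ LowerPt.rep y, (upperObj S).prec (UpperPt.mk X) V := by
  refine (star_duality S.prec x y).trans ?_
  exact forall₂_congr fun X _ => exists_congr fun V => and_congr_right fun _ =>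
    (upper_prec_mk X V).symm

/-- The distributive law `σ : P_U (P_L S) ⟶ P_L (P_U S)`: `𝒰 σ 𝒱` if and only if
`𝒰 (≺_L)_U 𝒱^*`. -/
noncomputable def sigma (S : PxPos.{u}) : upperObj (lowerObj S) ⟶ lowerObj (upperObj S) :=
  Hom.ofUpper (S := lowerObj S) (T := lowerObj (upperObj S))
    (fun x y => ∀ B ∈ starU y, ∃ A ∈ UpperPt.rep x, lowerExt S.prec A.rep B)
    starU (fun A B => lowerExt S.prec (LowerPt.rep A) B) (fun _ _ => Iff.rfl)
    (fun B => LowerPt.isIdeal_forall (p := fun a => ∃ b ∈ B, S.prec a b)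
      (by rintro a a' h ⟨b, hb, hab⟩; exact ⟨b, hb, prec_le_left h hab⟩))
    (fun A B => by
      refine (lower_prec_mk A B).symm.trans (((lowerObj S).rounded A (LowerPt.mk B)).trans ?_)
      exact exists_congr fun A' => and_congr_right fun _ => lower_prec_mk A' B)
    (fun x y y' h hxy => by
      rw [sigma_dual] at hxy ⊢
      exact fun X hX => LowerPt.exists_rep_mono (S := upperObj S)
        (fun _ _ h h' => prec_le_right (S := upperObj S) h' h) h (hxy X hX))
    (fun x z => by
      simp only [sigma_dual]
      refine Iff.trans ?_ (exists_lowerPt_iff_of_finset (T := upperObj S) (starL x)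
        (q := fun X V => (upperObj S).prec (UpperPt.mk X) V)
        (p := fun V => ∃ V' ∈ LowerPt.rep z, (upperObj S).prec V V')
        (fun X _ _ h h' => prec_le_right (S := upperObj S) h' h)
        (by rintro V V' h ⟨W, hW, hVW⟩; exact ⟨W, hW, prec_le_left (S := upperObj S) h hVW⟩)).symm
      refine forall₂_congr fun X _ => ?_
      constructor
      · rintro ⟨W, hW, hXW⟩
        obtain ⟨V, h, h'⟩ := ((upperObj S).rounded _ W).1 hXW
        exact ⟨V, h, W, hW, h'⟩
      · rintro ⟨V, h, W, hW, h'⟩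
        exact ⟨W, hW, prec_trans (S := upperObj S) h h'⟩)

theorem sigma_rel (x : UpperPt (lowerObj S)) (y : LowerPt (upperObj S)) :
    (sigma S).rel x y ↔ ∀ X ∈ starL x, ∃ V ∈ LowerPt.rep y, (upperObj S).prec (UpperPt.mk X) V :=
  sigma_dual x y

theorem sigma_comp_rel (f : lowerObj (upperObj S) ⟶ T) {p : UpperPt S → T → Prop}
    (hp : ∀ a b t, a ≤ b → p b t → p a t) (hf : ∀ y t, f.rel y t ↔ ∀ V ∈ LowerPt.rep y, p V t)
    (x : UpperPt (lowerObj S)) (t : T) :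
    (sigma S ≫ f).rel x t ↔ ∀ X ∈ starL x, ∃ V, (upperObj S).prec (UpperPt.mk X) V ∧ p V t := by
  rw [comp_rel]
  simp only [sigma_rel, hf]
  exact exists_lowerPt_iff_of_finset (T := upperObj S) (starL x)
    (q := fun X V => (upperObj S).prec (UpperPt.mk X) V) (p := fun V => p V t)
    (fun X _ _ h h' => prec_le_right (S := upperObj S) h' h) (fun a b => hp a b t)

theorem sigma_lowerMap_rel (f : upperObj S ⟶ T) (x : UpperPt (lowerObj S)) (z : LowerPt T) :
    (sigma S ≫ lowerMap f).rel x z ↔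
      ∀ X ∈ starL x, ∃ c ∈ z.rep, f.rel (UpperPt.mk X) c := by
  refine (sigma_comp_rel (lowerMap f) (p := fun V z => ∃ c ∈ LowerPt.rep z, f.rel V c) ?_
    (fun _ _ => Iff.rfl) x z).trans ?_
  · rintro V V' z h ⟨c, hc, hVc⟩
    exact ⟨c, hc, f.le_left h hVc⟩
  · refine forall₂_congr fun X _ => ?_
    constructor
    · rintro ⟨V, h, c, hc, hVc⟩
      exact ⟨c, hc, f.prec_left h hVc⟩
    · rintro ⟨c, hc, h⟩
      obtain ⟨V, h1, h2⟩ := (f.rounded_left _ c).1 h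
      exact ⟨V, h1, c, hc, h2⟩

theorem upperMap_sigma_rel (g : T ⟶ lowerObj S) (x : UpperPt T) (y : LowerPt (upperObj S)) :
    (upperMap g ≫ sigma S).rel x y ↔
      ∀ B ∈ starU y, ∃ A ∈ x.rep, g.rel A (LowerPt.mk B) := by
  refine (upperMap_comp_rel g (sigma S) (C := starU)
    (p := fun A B => lowerExt S.prec (LowerPt.rep A) B) ?_ (fun _ _ => Iff.rfl) x y).trans ?_
  · intro A A' B h hB
    exact (lower_prec_mk A B).1 (prec_le_left (S := lowerObj S) h ((lower_prec_mk A' B).2 hB))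
  · refine forall₂_congr fun B _ => exists_congr fun A => and_congr_right fun _ => ?_
    refine Iff.trans ?_ (g.rounded_right A (LowerPt.mk B)).symm
    exact exists_congr fun A' => and_congr_right fun _ => (lower_prec_mk A' B).symm

/-- The distributive law of the lower powerlocale over the upper powerlocale. -/
noncomputable def distributiveLaw :
    ComonadDistributiveLaw lowerPowerlocale.{u} upperPowerlocale.{u} where
  σ :=
    { app := sigma
      naturality := by
        intro S S' r
        refine hom_ext fun x y => ?_
        refine (upperMap_sigma_rel (lowerMap r) x y).trans ?_
        refine Iff.trans ?_ (sigma_lowerMap_rel (upperMap r) x y).symm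
        simp only [lowerMap_rel_mk, upperMap_mk_rel]
        exact star_duality r.rel x y }
  counit_T := by
    intro S
    refine hom_ext fun x z => ?_
    refine (sigma_lowerMap_rel (upperCounit S) x z).trans ?_
    refine Iff.trans ?_ (upperCounit_rel (S := lowerObj S) x z).symm
    have h : ∀ X c, (upperCounit S).rel (UpperPt.mk X) c ↔ ∃ a ∈ X, S.prec a c := fun X c =>
      (upperCounit_rel _ c).trans (UpperPt.exists_rep_mk (fun _ _ h h' => prec_le_left h h') X)
    simp only [h]
    constructor
    · intro h
      rcases exists_starL_or x (fun a => ¬ ∃ c ∈ LowerPt.rep z, S.prec a c) with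
        ⟨X, hX, hX'⟩ | ⟨A, hA, hA'⟩
      · obtain ⟨c, hc, a, ha, hac⟩ := h X hX
        exact absurd ⟨c, hc, hac⟩ (hX' a ha)
      · exact ⟨A, hA, fun a ha => not_not.1 (hA' a ha)⟩
    · rintro ⟨A, hA, hAz⟩ X hX
      obtain ⟨a, ha, haX⟩ := starL_meets hX hA
      obtain ⟨c, hc, hac⟩ := hAz a ha
      exact ⟨c, hc, a, haX, hac⟩
  counit_K := by
    intro S
    refine hom_ext fun x v => ?_
    refine (sigma_comp_rel (lowerCounit (upperObj S)) (p := (upperObj S).prec)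
      (fun _ _ _ => prec_le_left (S := upperObj S)) lowerCounit_rel x v).trans ?_
    refine Iff.trans (forall₂_congr fun X _ => ((upperObj S).rounded (UpperPt.mk X) v).symm) ?_
    refine Iff.trans ?_ (forall₂_congr fun b _ => exists_congr fun A => and_congr_right fun _ =>
      (lowerCounit_rel A b).symm)
    refine Iff.trans (forall₂_congr fun X _ => upper_prec_mk X v) ?_
    constructor
    · intro h b hb
      rcases exists_starL_or x (fun a => ¬ S.prec a b) with ⟨X, hX, hX'⟩ | ⟨A, hA, hA'⟩
      · obtain ⟨a, ha, hab⟩ := h X hX b hb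
        exact absurd hab (hX' a ha)
      · exact ⟨A, hA, fun a ha => not_not.1 (hA' a ha)⟩
    · intro h X hX b hb
      obtain ⟨A, hA, hAb⟩ := h b hb
      obtain ⟨a, ha, haX⟩ := starL_meets hX hA
      exact ⟨a, haX, hAb a ha⟩
  comult_K := by
    classical
    intro S
    rw [← Category.assoc]
    refine hom_ext fun x z => ?_
    have r_mono : ∀ {a a' : S} {A : LowerPt S}, a ≤ a' → (∃ b ∈ A.rep, S.prec a' b) →
        ∃ b ∈ A.rep, S.prec a b := by
      rintro a a' A h ⟨b, hb, hab⟩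
      exact ⟨b, hb, prec_le_left h hab⟩
    have h1 : ∀ y : LowerPt (upperObj (lowerObj S)),
        (upperMap (lowerComult S) ≫ sigma (lowerObj S)).rel x y ↔ ∀ X ∈ starL x,
          ∃ W ∈ LowerPt.rep y,
            upperExt (fun a (A : lowerObj S) => ∃ b ∈ LowerPt.rep A, S.prec a b) X
              (UpperPt.rep W) := by
      intro y
      refine (upperMap_sigma_rel (lowerComult S) x y).trans ?_
      refine Iff.trans ?_ (star_duality
        (fun a (A : lowerObj S) => ∃ b ∈ LowerPt.rep A, S.prec a b) x y)
      refine forall₂_congr fun B _ => exists_congr fun A => and_congr_right fun _ => ?_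
      exact (lowerComult_rel A _).trans (forall₂_congr fun a _ => belowUnion_mk)
    have h2 : ((upperMap (lowerComult S) ≫ sigma (lowerObj S)) ≫ lowerMap (sigma S)).rel x z ↔
        ∀ X ∈ starL x, ∃ W : UpperPt (lowerObj S),
          upperExt (fun a (A : lowerObj S) => ∃ b ∈ LowerPt.rep A, S.prec a b) X W.rep ∧
            ∃ z' ∈ LowerPt.rep z, (sigma S).rel W z' := by
      refine Iff.trans (exists_congr fun y => and_congr_left fun _ => h1 y) ?_
      refine exists_lowerPt_iff_of_finset (T := upperObj (lowerObj S)) (starL x)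
        (q := fun X W => upperExt (fun a (A : lowerObj S) => ∃ b ∈ LowerPt.rep A, S.prec a b) X
          (UpperPt.rep W))
        (p := fun W => ∃ z' ∈ LowerPt.rep z, (sigma S).rel W z') ?_ ?_
      · intro X W W' h hW
        refine UpperPt.forall_rep_mono (S := lowerObj S)
          (p := fun A => ∃ a ∈ X, ∃ b ∈ LowerPt.rep A, S.prec a b) ?_ h hW
        rintro A A' hA ⟨a, ha, h⟩
        exact ⟨a, ha, LowerPt.exists_rep_mono (fun _ _ h h' => prec_le_right h' h) hA h⟩
      · rintro W W' h ⟨z', hz', h'⟩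
        exact ⟨z', hz', (sigma S).le_left h h'⟩
    refine h2.trans ?_
    refine Iff.trans ?_ (sigma_comp_rel (lowerComult (upperObj S)) (p := belowUnion (upperObj S)) ?_
      lowerComult_rel x z).symm
    · refine forall₂_congr fun X _ => ?_
      constructor
      · rintro ⟨W, hW, z', hz', hWz⟩
        have hW' : ∀ A ∈ UpperPt.rep W, ∃ b ∈ A.rep, ∃ a ∈ X, S.prec a b := by
          intro A hA
          obtain ⟨a, ha, b, hb, hab⟩ := hW A hA
          exact ⟨b, hb, a, ha, hab⟩
        rcases exists_starL_or W (fun b => ∃ a ∈ X, S.prec a b) with ⟨Y, hY, hY'⟩ | ⟨A, hA, hA'⟩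
        · obtain ⟨V', hV', h⟩ := (sigma_rel W z').1 hWz Y hY
          refine ⟨UpperPt.mk Y, (upper_prec_mk _ _).2 ?_, z', hz', V', hV', h⟩
          refine (UpperPt.forall_rep_mk (p := fun b => ∃ a ∈ X, S.prec a b) ?_ Y).2 hY'
          rintro b b' h ⟨a, ha, hab⟩
          exact ⟨a, ha, prec_le_right hab h⟩
        · obtain ⟨b, hb, h⟩ := hW' A hA
          exact absurd h (hA' b hb)
      · rintro ⟨V, hXV, z', hz', V', hV', hVV'⟩
        refine ⟨UpperPt.mk (S := lowerObj S) (V.rep.image fun v => LowerPt.mk {v}), ?_, z', hz', ?_⟩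
        · refine (UpperPt.forall_rep_mk (S := lowerObj S)
            (p := fun A => ∃ a ∈ X, ∃ b ∈ LowerPt.rep A, S.prec a b) ?_ _).2 ?_
          · rintro A A' hA ⟨a, ha, h⟩
            exact ⟨a, ha, LowerPt.exists_rep_mono (fun _ _ h h' => prec_le_right h' h) hA h⟩
          · intro A hA
            obtain ⟨v, hv, rfl⟩ := Finset.mem_image.1 hA
            obtain ⟨a, ha, hav⟩ := (upper_prec_mk X V).1 hXV v hv
            exact ⟨a, ha, exists_rep_singleton.2 hav⟩
        · intro B hB
          obtain ⟨v', hv', hv'B⟩ := starU_meets hB hV'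
          obtain ⟨v, hv, hvv'⟩ := hVV' v' hv'
          refine (UpperPt.exists_rep_mk (S := lowerObj S)
            (p := fun A => lowerExt S.prec (LowerPt.rep A) B) ?_ _).2 ?_
          · intro A A' h hB
            exact (lower_prec_mk A B).1
              (prec_le_left (S := lowerObj S) h ((lower_prec_mk A' B).2 hB))
          · refine ⟨LowerPt.mk {v}, Finset.mem_image_of_mem _ hv, ?_⟩
            refine (forall_rep_singleton (p := fun a => ∃ b ∈ B, S.prec a b) ?_ v).2
              ⟨v', hv'B, hvv'⟩
            rintro a a' h ⟨b, hb, hab⟩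
            exact ⟨b, hb, prec_le_left h hab⟩
    · rintro V V' z h ⟨z', hz', V'', hV'', h'⟩
      exact ⟨z', hz', V'', hV'', prec_le_left (S := upperObj S) h h'⟩
  comult_T := by
    intro S
    refine hom_ext fun x y => ?_
    refine (upperComult_comp_rel (upperMap (sigma S) ≫ sigma (upperObj S)) (C := starU)
      (p := fun Z B => (sigma S).rel Z (LowerPt.mk B)) (fun _ _ _ => (sigma S).le_left)
      (upperMap_sigma_rel (sigma S)) x y).trans ?_
    refine Iff.trans (forall₂_congr fun B _ =>
      ((sigma S).rounded_left x (LowerPt.mk B)).symm) ?_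
    refine Iff.trans ?_ (sigma_lowerMap_rel (upperComult S) x y).symm
    have h : ∀ B : Finset (upperObj S), (sigma S).rel x (LowerPt.mk B) ↔
        ∀ X ∈ starL x, ∃ V ∈ B, (upperObj S).prec (UpperPt.mk X) V := fun B =>
      (sigma_rel x _).trans (forall₂_congr fun X _ => LowerPt.exists_rep_mk (S := upperObj S)
        (fun _ _ h h' => prec_le_right (S := upperObj S) h' h) B)
    simp only [upperComult_rel]
    constructor
    · intro H X hX
      rcases exists_starU_or y (fun V => ¬ (upperObj S).prec (UpperPt.mk X) V) with
        ⟨B, hB, hB'⟩ | ⟨V, hV, hV'⟩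
      · obtain ⟨V, hV, hXV⟩ := (h B).1 (H B hB) X hX
        exact absurd hXV (hB' V hV)
      · exact ⟨V, hV, fun b hb => not_not.1 (hV' b hb)⟩
    · intro H B hB
      refine (h B).2 fun X hX => ?_
      obtain ⟨V, hV, hXV⟩ := H X hX
      obtain ⟨b, hb, hbB⟩ := starU_meets hB hV
      exact ⟨b, hbB, hXV b hb⟩

end Laws

/-- The double powerlocale: the composite comonad `P_U ∘ P_L`. -/
noncomputable def doublePowerlocale : Comonad PxPos.{u} :=
  distributiveLaw.composite

end PxPos

/-! ### Locally compact locales -/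

/-- `y` is way below `x` in a complete lattice. -/
def WayBelow {L : Type u} [CompleteLattice L] (y x : L) : Prop :=
  ∀ U : Set L, U.Nonempty → DirectedOn (· ≤ ·) U → x ≤ sSup U → ∃ z ∈ U, y ≤ z

/-- A complete lattice is continuous if every element is the directed join of the elements
way below it. -/
def IsContinuousLattice (L : Type u) [CompleteLattice L] : Prop :=
  ∀ x : L, {y : L | WayBelow y x}.Nonempty ∧ DirectedOn (· ≤ ·) {y : L | WayBelow y x} ∧
    sSup {y : L | WayBelow y x} = x

/-- The category of locally compact locales: the full subcategory of the category of locales on the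
locales whose frame is a continuous lattice. -/
abbrev LocallyCompactLocale : Type (u + 1) :=
  ObjectProperty.FullSubcategory fun X : Locale.{u} => IsContinuousLattice X

/-! An element of `P_U P_L S` is a formal finite meet of formal finite joins of elements of `S`. A
continuous lattice `L` with its way-below relation is a proximity poset. An approximable relation
`r` from it to `T` amounts to a monotone map `Hom.supMap r` from `T` to `L` that is continuous for
`≺`: `r` relates `a` to `t` exactly when `a` is way below `supMap r t` (`Hom.rel_iff`). Evaluation
of formal meets of joins, `meetJoin id`, thus yields a structure map on `L`. Its counit law says
that `{{b}}` evaluates to `b`. Its coassociativity equates meets of joins over transversals with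
joins of meets, which is finite distributivity and so holds in a frame (`structureMap_coassoc`).

A relation between two such coalgebras is a homomorphism exactly when its map preserves finite meets
of finite joins. With the continuity that every approximable relation has, this makes the map a
frame homomorphism. Both frame homomorphisms and the maps `supMap r` run against the arrows, so
`localeToCoalgebra` is a covariant, full and faithful functor.

For essential surjectivity, `Covers C a U` is read as "`a` is approximated by the meet of joins
`U`". The counit law becomes `covers_singleton` and coassociativity becomes `covers_coassoc`. The
rounded ideals of `C.A` form a complete lattice in which a join consists of the elements covered by
a finite join from the union. Coassociativity gives the frame law (`Points.inf_sSup_le`). Directed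
joins are unions, so way-below is detected by principal ideals (`Points.wayBelow_iff`) and the frame
is continuous. Membership of elements in rounded ideals is then an isomorphism of coalgebras
(`Points.coalgebraIso`). -/

namespace PxPos

/-! ### The relations underlying the double powerlocale -/

section DoublePowerlocale

variable {S S' : PxPos.{u}}

theorem doublePowerlocale_map_rel (r : S ⟶ S') (x : UpperPt (LowerPt S))
    (y : UpperPt (LowerPt S')) :
    Hom.rel (doublePowerlocale.map r) x y ↔
      ∀ B ∈ y.rep, ∃ A ∈ x.rep, ∀ a ∈ A.rep, ∃ b ∈ B.rep, r.rel a b := Iff.rfl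

/-- The two counits contribute one step of `≺` each, and roundedness merges them into one. -/
theorem doublePowerlocale_counit_rel (x : UpperPt (LowerPt S)) (b : S) :
    Hom.rel (doublePowerlocale.ε.app S) x b ↔ ∃ A ∈ x.rep, ∀ a ∈ A.rep, S.prec a b := by
  refine (upperMap_comp_rel (lowerCounit S) (upperCounit S) (C := fun t => {t}) (p := S.prec)
    (fun _ _ _ => prec_le_left) (fun x t => by simp [upperCounit_rel]) x b).trans ?_
  simp only [Finset.mem_singleton, forall_eq]
  refine exists_congr fun A => and_congr_right fun _ => ?_
  exact ((lowerCounit S).rounded_right A b).symm.trans (lowerCounit_rel A b)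

/-- The intermediate families of the three composed relations are all absorbed by roundedness. What
remains is one `≺` and the transversals introduced by `sigma`. -/
theorem doublePowerlocale_comult_rel (x : UpperPt (LowerPt S))
    (W : UpperPt (LowerPt (UpperPt (LowerPt S)))) :
    Hom.rel (doublePowerlocale.δ.app S) x W ↔
      ∀ C ∈ W.rep, ∀ B ∈ starU (S := lowerObj S) C, ∃ A ∈ x.rep, ∀ a ∈ A.rep,
        ∃ y ∈ B, ∃ b ∈ y.rep, S.prec a b := by
  classical
  -- `upperMap_comp_rel` needs one finite family of conditions, so the transversals of all members
  -- of `W` are pooled in a union.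
  have h1 : ∀ (U : UpperPt (LowerPt (LowerPt S))) (W : UpperPt (LowerPt (UpperPt (LowerPt S)))),
      (upperComult (lowerObj (lowerObj S)) ≫ upperMap (sigma (lowerObj S))).rel U W ↔
        ∀ B ∈ W.rep.biUnion (starU (S := lowerObj S)), ∃ A ∈ U.rep,
          lowerExt (lowerObj S).prec A.rep B := by
    intro U W
    refine (upperComult_comp_rel (upperMap (sigma (lowerObj S))) (C := fun W => UpperPt.rep W)
      (p := (sigma (lowerObj S)).rel) (fun _ _ _ => (sigma (lowerObj S)).le_left)
      (fun _ _ => Iff.rfl) U W).trans ?_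
    simp only [Finset.mem_biUnion, forall_exists_index, and_imp]
    rw [forall_comm]
    refine forall_congr' fun C => ?_
    refine Iff.trans ?_ forall_comm
    refine forall_congr' fun hC => ?_
    exact ((sigma (lowerObj S)).rounded_left U C).symm
  refine (upperMap_comp_rel (lowerComult S)
    (upperComult (lowerObj (lowerObj S)) ≫ upperMap (sigma (lowerObj S)))
    (p := fun A B => lowerExt (lowerObj S).prec
    (LowerPt.rep (S := lowerObj S) A) B) ?_ h1 x W).trans ?_
  · intro A A' B h hB
    exact (lower_prec_mk (S := lowerObj S) A B).1 (prec_le_left (S := lowerObj (lowerObj S)) h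
      ((lower_prec_mk (S := lowerObj S) A' B).2 hB))
  · simp only [Finset.mem_biUnion, forall_exists_index, and_imp]
    rw [forall_comm]
    refine forall_congr' fun C => ?_
    refine forall_comm.trans ?_
    refine forall_congr' fun hC => forall₂_congr fun B hB => ?_
    refine exists_congr fun A => and_congr_right fun _ => ?_
    refine (exists_congr fun A' => and_congr_right fun _ =>
      (lower_prec_mk (S := lowerObj S) A' B).symm).trans ?_
    refine ((lowerComult S).rounded_right A (LowerPt.mk (S := lowerObj S) B)).symm.trans ?_
    exact (lowerComult_rel A _).trans (forall₂_congr fun a _ => belowUnion_mk)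

end DoublePowerlocale

/-! ### Formal meets of formal joins -/

section DoubleFin

variable {S : Type u} [PartialOrder S]

open Classical in
/-- The element of the double powerlocale given by a finite family of finite sets. -/
noncomputable def doubleMk (U : Finset (Finset S)) : UpperPt (LowerPt S) :=
  UpperPt.mk (U.image LowerPt.mk)

theorem forall_doubleMk {p : LowerPt S → Prop} (hp : ∀ A B, A ≤ B → p A → p B)
    (U : Finset (Finset S)) :
    (∀ A ∈ (doubleMk U).rep, p A) ↔ ∀ A ∈ U, p (LowerPt.mk A) := by
  classical
  rw [doubleMk, UpperPt.forall_rep_mk hp, Finset.forall_mem_image]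

theorem exists_doubleMk {p : LowerPt S → Prop} (hp : ∀ A B, A ≤ B → p B → p A)
    (U : Finset (Finset S)) :
    (∃ A ∈ (doubleMk U).rep, p A) ↔ ∃ A ∈ U, p (LowerPt.mk A) := by
  classical
  rw [doubleMk, UpperPt.exists_rep_mk hp, Finset.exists_mem_image]

theorem exists_doubleMk_forall {p : S → Prop} (hp : ∀ a b, a ≤ b → p b → p a)
    (U : Finset (Finset S)) :
    (∃ A ∈ (doubleMk U).rep, ∀ a ∈ A.rep, p a) ↔ ∃ A ∈ U, ∀ a ∈ A, p a := by
  rw [exists_doubleMk fun A B h => LowerPt.forall_rep_mono hp h]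
  simp only [LowerPt.forall_rep_mk hp]

theorem doubleMk_rep (x : UpperPt (LowerPt S)) [DecidableEq (Finset S)] :
    doubleMk (x.rep.image LowerPt.rep) = x := by
  classical
  rw [doubleMk, Finset.image_image]
  conv_rhs => rw [← UpperPt.mk_rep x]
  congr 1
  ext A
  simp [LowerPt.mk_rep]

theorem doubleMk_le_doubleMk {U V : Finset (Finset S)} :
    doubleMk U ≤ doubleMk V ↔ ∀ B ∈ V, ∃ A ∈ U, ∀ a ∈ A, ∃ b ∈ B, a ≤ b := by
  classical
  refine UpperPt.mk_le_mk.trans ?_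
  simp only [upperExt, Finset.forall_mem_image, Finset.exists_mem_image, LowerPt.mk_le_mk, lowerExt]

end DoubleFin

end PxPos

/-! ### Continuous lattices -/

section WayBelow

variable {L : Type u} [CompleteLattice L]

theorem WayBelow.le {y x : L} (h : WayBelow y x) : y ≤ x := by
  obtain ⟨z, rfl, hz⟩ := h {x} (Set.singleton_nonempty x)
    (by rintro _ rfl _ rfl; exact ⟨_, rfl, le_rfl, le_rfl⟩) (by simp)
  exact hz

theorem WayBelow.trans_le {y x x' : L} (h : WayBelow y x) (h' : x ≤ x') : WayBelow y x' :=
  fun U h1 h2 h3 => h U h1 h2 (h'.trans h3)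

theorem WayBelow.le_trans {y y' x : L} (h : WayBelow y x) (h' : y' ≤ y) : WayBelow y' x :=
  fun U h1 h2 h3 => let ⟨z, hz, hyz⟩ := h U h1 h2 h3; ⟨z, hz, h'.trans hyz⟩

/-- An element way below a join lies below a finite part of the join. -/
theorem WayBelow.exists_finset {y : L} {E : Set L} (h : WayBelow y (sSup E)) :
    ∃ A : Finset L, (∀ a ∈ A, a ∈ E) ∧ y ≤ A.sup id := by
  classical
  obtain ⟨_, ⟨A, hA, rfl⟩, h⟩ := h {z | ∃ A : Finset L, (∀ a ∈ A, a ∈ E) ∧ A.sup id = z}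
    ⟨⊥, ∅, by simp, rfl⟩ (by
      rintro _ ⟨A, hA, rfl⟩ _ ⟨B, hB, rfl⟩
      refine ⟨_, ⟨A ∪ B, fun a ha => ?_, rfl⟩, Finset.sup_mono Finset.subset_union_left,
        Finset.sup_mono Finset.subset_union_right⟩
      rcases Finset.mem_union.1 ha with ha | ha
      exacts [hA a ha, hB a ha]) (by
      refine sSup_le_sSup fun e he => ⟨{e}, by simpa using he, by simp⟩)
  exact ⟨A, hA, h⟩

namespace IsContinuousLattice

theorem le_of_forall (hL : IsContinuousLattice L) {x y : L} (h : ∀ a, WayBelow a x → a ≤ y) :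
    x ≤ y := by
  rw [← (hL x).2.2]
  exact sSup_le h

theorem eq_of_forall (hL : IsContinuousLattice L) {x y : L}
    (h : ∀ a, WayBelow a x ↔ WayBelow a y) : x = y :=
  le_antisymm (hL.le_of_forall fun a ha => ((h a).1 ha).le)
    (hL.le_of_forall fun a ha => ((h a).2 ha).le)

/-- Interpolation: the elements reached from `x` by two way-below steps down form a directed set
whose join is still above `x`, so one of them is above `y`. -/
theorem exists_between (hL : IsContinuousLattice L) {x y : L} (h : WayBelow y x) :
    ∃ z, WayBelow y z ∧ WayBelow z x := by
  obtain ⟨c, ⟨b, hcb, hbx⟩, hyc⟩ := h {c | ∃ b, WayBelow c b ∧ WayBelow b x} (by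
      obtain ⟨b, hb⟩ := (hL x).1
      obtain ⟨c, hc⟩ := (hL b).1
      exact ⟨c, b, hc, hb⟩) (by
      rintro c ⟨b, hcb, hb⟩ c' ⟨b', hcb', hb'⟩
      obtain ⟨d, hd, hbd, hbd'⟩ := (hL x).2.1 b hb b' hb'
      obtain ⟨e, he, hce, hce'⟩ := (hL d).2.1 c (hcb.trans_le hbd) c' (hcb'.trans_le hbd')
      exact ⟨e, ⟨d, he, hd⟩, hce, hce'⟩) (by
      refine hL.le_of_forall fun b hb => hL.le_of_forall fun c hc => ?_
      exact le_sSup ⟨b, hc, hb⟩)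
  exact ⟨b, hcb.le_trans hyc, hbx⟩

theorem isIdeal (hL : IsContinuousLattice L) (x : L) : Order.IsIdeal {y | WayBelow y x} where
  IsLowerSet _ _ h h' := WayBelow.le_trans h' h
  Nonempty := (hL x).1
  Directed := (hL x).2.1

end IsContinuousLattice

end WayBelow

namespace PxPos

/-- A continuous lattice is a proximity poset with respect to the way below relation. -/
@[reducible]
def ofContinuousLattice (L : Type u) [CompleteLattice L] (hL : IsContinuousLattice L) :
    PxPos.{u} where
  carrier := L
  prec := WayBelow
  approx := ⟨hL.isIdeal, fun _ _ _ h h' => WayBelow.trans_le h' h⟩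
  rounded _ _ := ⟨hL.exists_between, fun ⟨_, h, h'⟩ => h.trans_le h'.le⟩

section ContinuousLattice

variable {L : Type u} [CompleteLattice L] {hL : IsContinuousLattice L} {T : PxPos.{u}}

/-- A monotone map that is continuous with respect to `≺` gives an approximable relation. -/
def Hom.ofMap (hL : IsContinuousLattice L) (f : T → L) (hf : Monotone f)
    (h_prec : ∀ {t t'}, T.prec t' t → f t' ≤ f t)
    (h_cont : ∀ {a t}, WayBelow a (f t) → ∃ t', a ≤ f t' ∧ T.prec t' t) :
    ofContinuousLattice L hL ⟶ T where
  rel a t := WayBelow a (f t)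
  approx := ⟨fun t => hL.isIdeal (f t), fun _ _ _ h h' => WayBelow.trans_le h' (hf h)⟩
  rounded_left a t := (ofContinuousLattice L hL).rounded a (f t)
  rounded_right a t := by
    constructor
    · intro h
      -- `h_cont` only yields `≤`; the interpolated `b` restores way-below for `a`.
      obtain ⟨b, hab, hb⟩ := hL.exists_between h
      obtain ⟨t', h1, h2⟩ := h_cont hb
      exact ⟨t', hab.trans_le h1, h2⟩
    · rintro ⟨t', h1, h2⟩
      exact h1.trans_le (h_prec h2)

/-- The map given by an approximable relation out of a continuous lattice. -/
def Hom.supMap (r : ofContinuousLattice L hL ⟶ T) (t : T) : L := sSup {a | r.rel a t}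

/-- The set of all `a` related to `t` is a rounded ideal: roundedness gives one direction,
directedness the other. Relations out of a continuous lattice can thus be handled as maps into it.
-/
theorem Hom.rel_iff (r : ofContinuousLattice L hL ⟶ T) (a : L) (t : T) :
    r.rel a t ↔ WayBelow a (Hom.supMap r t) := by
  constructor
  · intro h
    obtain ⟨b, hab, hb⟩ := (r.rounded_left a t).1 h
    exact WayBelow.trans_le hab (le_sSup hb)
  · intro h
    obtain ⟨b, hb, hab⟩ := h _ (r.approx.isIdeal t).Nonempty (r.approx.isIdeal t).Directed le_rfl
    exact r.le_left hab hb

theorem Hom.supMap_mono (r : ofContinuousLattice L hL ⟶ T) : Monotone (Hom.supMap r) :=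
  fun _ _ h => sSup_le_sSup fun _ ha => r.le_right ha h

end ContinuousLattice

/-! ### Meets of joins -/

section MeetJoin

variable {S : Type u} [PartialOrder S] {L : Type u} [CompleteLattice L]

/-- The value of a formal meet of formal joins under a map to a complete lattice. -/
noncomputable def meetJoin (f : S → L) (x : UpperPt (LowerPt S)) : L :=
  x.rep.inf fun A => A.rep.sup f

theorem le_meetJoin_iff {f : S → L} {x : UpperPt (LowerPt S)} {c : L} :
    c ≤ meetJoin f x ↔ ∀ A ∈ x.rep, c ≤ A.rep.sup f :=
  Finset.le_inf_iff

theorem meetJoin_le {f : S → L} {x : UpperPt (LowerPt S)} {A : LowerPt S} (hA : A ∈ x.rep) :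
    meetJoin f x ≤ A.rep.sup f :=
  Finset.inf_le hA

theorem sup_rep_mono {f : S → L} (hf : Monotone f) :
    Monotone fun A : LowerPt S => A.rep.sup f := by
  intro A B h
  refine Finset.sup_le fun a ha => ?_
  obtain ⟨b, hb, hab⟩ := LowerPt.le_iff.1 h a ha
  exact (hf hab).trans (Finset.le_sup hb)

theorem sup_rep_mk {f : S → L} (hf : Monotone f) (A : Finset S) :
    (LowerPt.mk A).rep.sup f = A.sup f := by
  refine eq_of_forall_ge_iff fun c => ?_
  simp only [Finset.sup_le_iff]
  exact LowerPt.forall_rep_mk (fun _ _ h h' => (hf h).trans h') A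

theorem meetJoin_mono {f : S → L} (hf : Monotone f) : Monotone (meetJoin f) := by
  intro x y h
  refine le_meetJoin_iff.2 fun B hB => ?_
  obtain ⟨A, hA, hAB⟩ := UpperPt.le_iff.1 h B hB
  exact (meetJoin_le hA).trans (sup_rep_mono hf hAB)

theorem meetJoin_doubleMk {f : S → L} (hf : Monotone f) (U : Finset (Finset S)) :
    meetJoin f (doubleMk U) = U.inf fun A => A.sup f := by
  refine eq_of_forall_le_iff fun c => ?_
  rw [le_meetJoin_iff, forall_doubleMk (p := fun A => c ≤ A.rep.sup f)
    fun A B h h' => h'.trans (sup_rep_mono hf h)]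
  simp only [sup_rep_mk hf, Finset.le_inf_iff]

end MeetJoin

/-! ### The structure map of a continuous lattice and its counit law. -/

section Coalgebra

variable {L : Type u} [CompleteLattice L] {hL : IsContinuousLattice L} {T : PxPos.{u}}

/-- Each condition yields a finite join from `E c` above `a`, and these joins together form one
formal meet. This supplies the intermediate element in composites with the structure map. Since the
`E c` are lower sets, the choice of representatives is harmless. -/
theorem exists_le_meetJoin {γ : Type u} (F : Finset γ) (E : γ → Set L)
    (hE : ∀ c, IsLowerSet (E c)) {a : L} (h : ∀ c ∈ F, WayBelow a (sSup (E c))) :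
    ∃ x : UpperPt (LowerPt L), a ≤ meetJoin id x ∧ ∀ c ∈ F, ∃ A ∈ x.rep, ∀ b ∈ A.rep, b ∈ E c := by
  obtain ⟨U, h1, h2⟩ := exists_finset_choice F fun c hc => (h c hc).exists_finset
  refine ⟨doubleMk U, ?_, fun c hc => ?_⟩
  · rw [meetJoin_doubleMk monotone_id]
    refine Finset.le_inf fun A hA => ?_
    obtain ⟨c, -, -, h⟩ := h2 A hA
    exact h
  · obtain ⟨A, hA, h, -⟩ := h1 c hc
    exact (exists_doubleMk_forall (fun _ _ h h' => hE c h h') U).2 ⟨A, hA, h⟩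

/-- This computes the structure map followed by the functorial action on `r`. It precedes the
definition of `structureMap` because the case of the identity provides the continuity required
there. -/
theorem exists_map_rel_iff (r : ofContinuousLattice L hL ⟶ T) (a : L) (y : UpperPt (LowerPt T)) :
    (∃ x : UpperPt (LowerPt L), WayBelow a (meetJoin id x) ∧
      Hom.rel (doublePowerlocale.map r) x y) ↔ WayBelow a (meetJoin (Hom.supMap r) y) := by
  simp only [doublePowerlocale_map_rel]
  constructor
  · rintro ⟨x, hx, hxy⟩
    refine hx.trans_le (le_meetJoin_iff.2 fun B hB => ?_)
    obtain ⟨A, hA, hAB⟩ := hxy B hB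
    refine (meetJoin_le hA).trans (Finset.sup_le fun a ha => ?_)
    obtain ⟨b, hb, hab⟩ := hAB a ha
    exact le_trans (le_sSup hab) (Finset.le_sup (f := Hom.supMap r) hb)
  · intro h
    -- `exists_le_meetJoin` bounds only by `≤`, so it is applied to an interpolated `b`.
    obtain ⟨b, hab, hb⟩ := hL.exists_between h
    obtain ⟨x, hx, h⟩ := exists_le_meetJoin y.rep
      (fun B : LowerPt T => {a : L | ∃ b ∈ B.rep, r.rel a b})
      (by rintro B a a' h ⟨b, hb, hab⟩; exact ⟨b, hb, r.le_left h hab⟩) (a := b)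
      (fun B hB => hb.trans_le ((meetJoin_le hB).trans (Finset.sup_le fun t ht =>
        sSup_le_sSup fun a ha => ⟨t, ht, ha⟩)))
    exact ⟨x, hab.trans_le hx, h⟩

/-- The structure map of the coalgebra given by a continuous lattice. -/
noncomputable def structureMap (hL : IsContinuousLattice L) :
    ofContinuousLattice L hL ⟶ doublePowerlocale.obj (ofContinuousLattice L hL) :=
  Hom.ofMap (T := upperObj (lowerObj (ofContinuousLattice L hL))) hL (meetJoin id)
    (meetJoin_mono monotone_id)
    (by
      intro x y h
      refine le_meetJoin_iff.2 fun B hB => ?_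
      obtain ⟨A, hA, hAB⟩ := h B hB
      refine (meetJoin_le hA).trans (Finset.sup_le fun a ha => ?_)
      obtain ⟨b, hb, hab⟩ := hAB a ha
      exact le_trans (WayBelow.le hab) (Finset.le_sup (f := id) hb))
    (by
      intro a y h
      -- Continuity of the lattice makes `meetJoin id` the instance of `meetJoin (Hom.supMap r)` at
      -- the identity relation.
      have h' : Hom.supMap (𝟙 (ofContinuousLattice L hL)) = id :=
        funext fun x => (hL x).2.2
      obtain ⟨x, h1, h2⟩ := (exists_map_rel_iff (𝟙 (ofContinuousLattice L hL)) a y).2 (h' ▸ h)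
      exact ⟨x, h1.le, h2⟩)

theorem supMap_structureMap : Hom.supMap (structureMap hL) = meetJoin id :=
  funext fun x => (hL (meetJoin id x)).2.2

theorem structureMap_comp_map_rel (r : ofContinuousLattice L hL ⟶ T) (a : L)
    (y : UpperPt (LowerPt T)) :
    Hom.rel (structureMap hL ≫ doublePowerlocale.map r) a y ↔
      WayBelow a (meetJoin (Hom.supMap r) y) :=
  exists_map_rel_iff r a y

theorem comp_structureMap_rel {M : Type u} [CompleteLattice M] {hM : IsContinuousLattice M}
    (r : ofContinuousLattice L hL ⟶ ofContinuousLattice M hM) (a : L) (x : UpperPt (LowerPt M)) :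
    Hom.rel (r ≫ structureMap hM) a x ↔ WayBelow a (Hom.supMap r (meetJoin id x)) :=
  (r.rounded_right a (meetJoin id x)).symm.trans (Hom.rel_iff r a _)

theorem structureMap_counit :
    structureMap hL ≫ doublePowerlocale.ε.app _ = 𝟙 (ofContinuousLattice L hL) := by
  refine hom_ext fun a b => ?_
  refine Iff.trans (exists_congr fun x => and_congr_right fun _ =>
    doublePowerlocale_counit_rel (S := ofContinuousLattice L hL) x b) ?_
  constructor
  · rintro ⟨x, hx, A, hA, hAb⟩
    exact WayBelow.trans_le hx ((meetJoin_le hA).trans (Finset.sup_le fun a ha => (hAb a ha).le))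
  · intro h
    obtain ⟨c, hac, hcb⟩ := hL.exists_between h
    -- The one-fold meet of the one-fold join of `c` evaluates to `c`.
    refine ⟨doubleMk {{c}}, ?_, (exists_doubleMk_forall (fun _ _ h h' => WayBelow.le_trans h' h)
      _).2 ⟨{c}, by simp, by simpa using hcb⟩⟩
    exact WayBelow.trans_le hac (by rw [meetJoin_doubleMk monotone_id]; simp)

end Coalgebra

/-! ### Coassociativity from finite distributivity. -/

section Frame

variable {L : Type u} [Order.Frame L] {hL : IsContinuousLattice L}

/-- The half of the identity between meets of joins over transversals and joins of meets that uses
distributivity. In the induction, the transversals `B ∪ {a}` with `a ∈ A` and `B` a transversal of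
`U` already suffice. -/
theorem inf_finsetStar_le {α : Type u} (f : α → L) (U : Finset (Finset α)) :
    ((finsetStar U).inf fun B => B.sup f) ≤ U.sup fun A => A.inf f := by
  classical
  induction U using Finset.induction_on with
  | empty => simp [finsetStar_empty]
  | insert A U _ ih =>
    rw [Finset.sup_insert]
    refine le_trans ?_ (sup_le_sup_left ih _)
    rw [Finset.inf_sup_distrib_right]
    refine Finset.le_inf fun a ha => ?_
    rw [Finset.inf_sup_distrib_left]
    refine Finset.le_inf fun B hB => ?_
    refine (Finset.inf_le ((mem_finsetStar_insert U A (B ∪ {a})).2 ⟨B, hB, {a},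
      by simpa using ha, Finset.singleton_nonempty a, rfl⟩)).trans ?_
    simp

/-- The easy half, without distributivity: an element common to `V` and `B` has its value between
the meet over `V` and the join over `B`. -/
theorem sup_inf_le_of_mem_starU {S : PxPos.{u}} (f : S → L) {y : LowerPt (upperObj S)}
    {B : Finset S} (hB : B ∈ starU y) : (y.rep.sup fun V => V.rep.inf f) ≤ B.sup f := by
  refine Finset.sup_le fun V hV => ?_
  obtain ⟨v, hv, hvB⟩ := starU_meets hB hV
  exact (Finset.inf_le hv).trans (Finset.le_sup hvB)

theorem inf_starU_le {S : PxPos.{u}} (f : S → L) (y : LowerPt (upperObj S)) :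
    ((starU y).inf fun B => B.sup f) ≤ y.rep.sup fun V => V.rep.inf f := by
  classical
  refine (inf_finsetStar_le f _).trans (Finset.sup_le fun A hA => ?_)
  obtain ⟨V, hV, rfl⟩ := Finset.mem_image.1 hA
  exact Finset.le_sup (f := fun V : UpperPt S => V.rep.inf f) hV

/-- Both composites evaluate the members of `W`: the comultiplication as meets of joins over
transversals, the functorial side as joins of meets. The two halves of finite distributivity give
the two directions. -/
theorem structureMap_coassoc :
    structureMap hL ≫ doublePowerlocale.δ.app _ =
      structureMap hL ≫ doublePowerlocale.map (structureMap hL) := by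
  classical
  refine hom_ext fun a W => ?_
  refine Iff.trans (exists_congr fun x => and_congr_right fun _ =>
    doublePowerlocale_comult_rel (S := ofContinuousLattice L hL) x W) ?_
  refine Iff.trans ?_ (structureMap_comp_map_rel (structureMap hL) a W).symm
  rw [supMap_structureMap]
  constructor
  · rintro ⟨x, hx, hxW⟩
    refine WayBelow.trans_le hx (le_meetJoin_iff.2 fun C hC => ?_)
    refine le_trans (Finset.le_inf fun B hB => ?_) (inf_starU_le
      (S := lowerObj (ofContinuousLattice L hL)) (fun A => (LowerPt.rep A).sup id) C)
    obtain ⟨A, hA, h⟩ := hxW C hC B hB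
    refine (meetJoin_le hA).trans (Finset.sup_le fun a ha => ?_)
    obtain ⟨y, hy, b, hb, hab⟩ := h a ha
    exact hab.le.trans ((Finset.le_sup (f := id) hb).trans
      (Finset.le_sup (f := fun A : LowerPt L => A.rep.sup id) hy))
  · intro h
    obtain ⟨c, hac, hc⟩ := hL.exists_between h
    -- A single `x` must serve all transversals of all members of `W`, hence the union as index set.
    obtain ⟨x, hx, h⟩ := exists_le_meetJoin
      (W.rep.biUnion (starU (S := lowerObj (ofContinuousLattice L hL))))
      (fun B => {a : L | ∃ y ∈ B, ∃ b ∈ LowerPt.rep y, WayBelow a b})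
      (by rintro B a a' h ⟨y, hy, b, hb, hab⟩; exact ⟨y, hy, b, hb, hab.le_trans h⟩) (a := c)
      (by
        intro B hB
        obtain ⟨C, hC, hB⟩ := Finset.mem_biUnion.1 hB
        refine hc.trans_le ((meetJoin_le hC).trans ?_)
        refine (sup_inf_le_of_mem_starU (S := lowerObj (ofContinuousLattice L hL))
          (fun A => (LowerPt.rep A).sup id) hB).trans ?_
        refine Finset.sup_le fun y hy => Finset.sup_le fun b hb => ?_
        exact hL.le_of_forall fun a ha => le_sSup ⟨y, hy, b, hb, ha⟩)
    exact ⟨x, hac.trans_le hx, fun C hC B hB => h B (Finset.mem_biUnion.2 ⟨C, hC, hB⟩)⟩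

end Frame

/-! ### The functor from locally compact locales to coalgebras -/

section FrameHom

variable {L M : Type u} [Order.Frame L] [Order.Frame M] {hL : IsContinuousLattice L}
  {hM : IsContinuousLattice M}

/-- The approximable relation given by a frame homomorphism. -/
def Hom.ofFrameHom (hL : IsContinuousLattice L) (hM : IsContinuousLattice M) (f : FrameHom M L) :
    ofContinuousLattice L hL ⟶ ofContinuousLattice M hM :=
  Hom.ofMap (T := ofContinuousLattice M hM) hL f (OrderHomClass.mono f)
    (fun h => OrderHomClass.mono f h.le)
    (by
      intro a t h
      -- As `f` preserves joins, `f t` is the directed join of the images of the elements way below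
      -- `t`.
      obtain ⟨_, ⟨t', ht', rfl⟩, ha⟩ := h (f '' {t' | WayBelow t' t}) ((hM t).1.image f)
        (by
          rintro _ ⟨x, hx, rfl⟩ _ ⟨y, hy, rfl⟩
          obtain ⟨z, hz, hxz, hyz⟩ := (hM t).2.1 x hx y hy
          exact ⟨_, ⟨z, hz, rfl⟩, OrderHomClass.mono f hxz, OrderHomClass.mono f hyz⟩)
        (by rw [← map_sSup, (hM t).2.2])
      exact ⟨t', ha, ht'⟩)

theorem Hom.supMap_ofFrameHom (f : FrameHom M L) : Hom.supMap (Hom.ofFrameHom hL hM f) = f :=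
  funext fun t => (hL (f t)).2.2

/-- Only preservation of finite meets and finite joins matters here; infinite joins entered through
`Hom.ofFrameHom`. -/
theorem ofFrameHom_isCoalgebraHom (f : FrameHom M L) :
    structureMap hL ≫ doublePowerlocale.map (Hom.ofFrameHom hL hM f) =
      Hom.ofFrameHom hL hM f ≫ structureMap hM := by
  refine hom_ext fun a y => (structureMap_comp_map_rel _ a y).trans ?_
  refine Iff.trans ?_ (comp_structureMap_rel _ a y).symm
  simp only [Hom.supMap_ofFrameHom, meetJoin, map_finset_inf, Function.comp_def, map_finset_sup, id]

/-- A coalgebra homomorphism between continuous frames gives a frame homomorphism. -/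
def Hom.toFrameHom (r : ofContinuousLattice L hL ⟶ ofContinuousLattice M hM)
    (hr : structureMap hL ≫ doublePowerlocale.map r = r ≫ structureMap hM) : FrameHom M L :=
  -- This is the homomorphism law read through `supMap`. The families `{A}`, `{{a}, {b}}` and `∅`
  -- specialise it to finite joins, binary meets and the top element.
  have h_meetJoin : ∀ U : Finset (Finset M),
      Hom.supMap r (U.inf fun A => A.sup _root_.id) = U.inf fun A => A.sup (Hom.supMap r) := by
    intro U
    refine hL.eq_of_forall fun a => ?_
    rw [← meetJoin_doubleMk monotone_id, ← meetJoin_doubleMk (Hom.supMap_mono r),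
      ← comp_structureMap_rel, ← hr, structureMap_comp_map_rel]
  have h_join : ∀ A : Finset M, Hom.supMap r (A.sup _root_.id) = A.sup (Hom.supMap r) := by
    intro A
    simpa using h_meetJoin {A}
  { toFun := Hom.supMap r
    map_inf' := by
      classical
      intro a b
      simpa using h_meetJoin {{a}, {b}}
    map_top' := by simpa using h_meetJoin ∅
    map_sSup' := by
      intro s
      refine le_antisymm (hL.le_of_forall fun a ha => ?_)
        (sSup_le (by rintro _ ⟨b, hb, rfl⟩; exact Hom.supMap_mono r (le_sSup hb)))
      -- Roundedness replaces the join by some `b` way below it, hence below a finite join, to which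
      -- `h_join` applies.
      obtain ⟨b, hab, hb⟩ := (r.rounded_right a _).1 ((Hom.rel_iff r a _).2 ha)
      obtain ⟨A, hA, hbA⟩ := WayBelow.exists_finset hb
      refine ((Hom.rel_iff r a b).1 hab).le.trans ((Hom.supMap_mono r hbA).trans ?_)
      rw [h_join]
      exact Finset.sup_le fun c hc => le_sSup ⟨c, hA c hc, rfl⟩ }

theorem Hom.ofFrameHom_toFrameHom (r : ofContinuousLattice L hL ⟶ ofContinuousLattice M hM)
    (hr : structureMap hL ≫ doublePowerlocale.map r = r ≫ structureMap hM) :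
    Hom.ofFrameHom hL hM (Hom.toFrameHom r hr) = r :=
  hom_ext fun a b => (Hom.rel_iff r a b).symm

end FrameHom

/-- The coalgebra of the double powerlocale given by a locally compact locale. -/
@[reducible]
noncomputable def coalgebraOfFrame (L : Type u) [Order.Frame L] (hL : IsContinuousLattice L) :
    doublePowerlocale.{u}.Coalgebra where
  A := ofContinuousLattice L hL
  a := structureMap hL
  counit := structureMap_counit
  coassoc := structureMap_coassoc

/-- The functor from locally compact locales to coalgebras of the double powerlocale. -/
noncomputable def localeToCoalgebra :
    LocallyCompactLocale.{u} ⥤ doublePowerlocale.{u}.Coalgebra where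
  obj X := coalgebraOfFrame X.obj X.property
  map {X Y} f :=
    { f := Hom.ofFrameHom X.property Y.property f.hom.unop.hom
      h := ofFrameHom_isCoalgebraHom _ }
  map_id X := by
    ext1
    exact hom_ext fun _ _ => Iff.rfl
  map_comp {X Y Z} f g := by
    ext1
    -- The composite asks for some `b` way below `g c` with `a` way below `f b`, which is right
    -- roundedness of the first relation at `g c`.
    exact hom_ext fun a c => Hom.rounded_right
      (Hom.ofFrameHom X.property Y.property f.hom.unop.hom) a (g.hom.unop.hom c)

instance : localeToCoalgebra.{u}.Faithful where
  map_injective {X Y f g} h := by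
    have h' : Hom.ofFrameHom X.property Y.property f.hom.unop.hom =
      Hom.ofFrameHom X.property Y.property g.hom.unop.hom := congrArg Comonad.Coalgebra.Hom.f h
    refine ObjectProperty.hom_ext _ (Quiver.Hom.unop_inj (Frm.ext fun y => ?_))
    exact congrFun ((Hom.supMap_ofFrameHom _).symm.trans
      ((congrArg Hom.supMap h').trans (Hom.supMap_ofFrameHom _))) y

instance : localeToCoalgebra.{u}.Full where
  map_surjective {X Y} r :=
    ⟨ObjectProperty.homMk (Quiver.Hom.op (Frm.ofHom (Hom.toFrameHom r.f r.h))), by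
      ext1
      exact Hom.ofFrameHom_toFrameHom r.f r.h⟩

/-! ### The frame of rounded ideals of a coalgebra -/

theorem doubleMk_surjective {S : Type u} [PartialOrder S] :
    Function.Surjective (doubleMk (S := S)) := by
  classical
  exact fun x => ⟨_, doubleMk_rep x⟩

/-- The quantification over `starU C` in the comultiplication of the double powerlocale in terms of
lower sets. -/
theorem forall_starU_iff {S : PxPos.{u}} {q : S → S → Prop} (hq : ∀ a b b', b ≤ b' → q a b → q a b')
    (x : UpperPt (LowerPt S)) (C : LowerPt (UpperPt (LowerPt S))) :
    (∀ B ∈ starU (S := lowerObj S) C, ∃ A ∈ x.rep, ∀ a ∈ A.rep, ∃ y ∈ B, ∃ b ∈ y.rep, q a b) ↔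
      ∀ p : LowerPt S → Prop, (∀ A B, A ≤ B → p B → p A) → (∀ V ∈ C.rep, ∃ y ∈ V.rep, p y) →
        ∃ A ∈ x.rep, ∀ a ∈ A.rep, ∃ y, p y ∧ ∃ b ∈ y.rep, q a b := by
  constructor
  · intro h p _ hC
    -- Either some transversal lies inside `p`, or some member of `C` misses `p`, which `hC`
    -- excludes.
    rcases exists_starU_or (S := lowerObj S) C p with ⟨B, hB, hBp⟩ | ⟨V, hV, hVp⟩
    · obtain ⟨A, hA, hAB⟩ := h B hB
      refine ⟨A, hA, fun a ha => ?_⟩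
      obtain ⟨y, hy, h⟩ := hAB a ha
      exact ⟨y, hBp y hy, h⟩
    · obtain ⟨y, hy, hpy⟩ := hC V hV
      exact absurd hpy (hVp y hy)
  · intro h B hB
    -- The lower set generated by the transversal `B`.
    obtain ⟨A, hA, h⟩ := h (fun y => ∃ y' ∈ B, y ≤ y')
      (by rintro A A' h ⟨y, hy, h'⟩; exact ⟨y, hy, h.trans h'⟩)
      (fun V hV => let ⟨y, hy, hyB⟩ := starU_meets (S := lowerObj S) hB hV
        ⟨y, hy, y, hyB, le_rfl⟩)
    refine ⟨A, hA, fun a ha => ?_⟩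
    obtain ⟨y, ⟨y', hy', hyy'⟩, h⟩ := h a ha
    exact ⟨y', hy', LowerPt.exists_rep_mono (hq a) hyy' h⟩

/-- Rounded ideals of a proximity poset. -/
structure RoundedIdeal (S : PxPos.{u}) : Type u where
  carrier : Set S
  isIdeal : Order.IsIdeal carrier
  rounded : ∀ a, a ∈ carrier ↔ ∃ b ∈ carrier, S.prec a b

namespace RoundedIdeal

variable {S : PxPos.{u}}

instance : SetLike (RoundedIdeal S) S where
  coe := carrier
  coe_injective I J h := by cases I; cases J; congr

instance : PartialOrder (RoundedIdeal S) := PartialOrder.ofSetLike _ _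

theorem mem_iff (I : RoundedIdeal S) {a : S} : a ∈ I ↔ ∃ b ∈ I, S.prec a b := I.rounded a

theorem mem_of_prec (I : RoundedIdeal S) {a b : S} (h : S.prec a b) (hb : b ∈ I) : a ∈ I :=
  I.mem_iff.2 ⟨b, hb, h⟩

/-- The rounded ideal of all elements `≺ b`. -/
def principal (b : S) : RoundedIdeal S where
  carrier := {a | S.prec a b}
  isIdeal := S.approx.isIdeal b
  rounded a := (S.rounded a b).trans (exists_congr fun _ => and_comm)

theorem principal_le {I : RoundedIdeal S} {b : S} (hb : b ∈ I) : principal b ≤ I :=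
  fun _ h => I.mem_of_prec h hb

end RoundedIdeal

/-! ### The coalgebra laws in terms of coverings. -/

section Coalgebra

variable {C : doublePowerlocale.{u}.Coalgebra}

variable (C) in
/-- `Covers C a U` holds if `a` lies in the formal meet of formal joins `U` according to the
structure map of the coalgebra `C`. -/
def Covers (a : C.A) (U : Finset (Finset C.A)) : Prop := Hom.rel C.a a (doubleMk U)

theorem covers_mono {a : C.A} {U V : Finset (Finset C.A)}
    (h : ∀ B ∈ V, ∃ A ∈ U, ∀ a ∈ A, ∃ b ∈ B, a ≤ b) (hU : Covers C a U) : Covers C a V :=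
  Hom.le_right C.a hU (doubleMk_le_doubleMk.2 h)

theorem covers_of_mem {a : C.A} {U : Finset (Finset C.A)} {A : Finset C.A} (hA : A ∈ U)
    (hU : Covers C a U) : Covers C a {A} :=
  covers_mono (by simpa using ⟨A, hA, fun a ha => ⟨a, ha, le_rfl⟩⟩) hU

theorem covers_iff_left {a : C.A} {U : Finset (Finset C.A)} :
    Covers C a U ↔ ∃ a', C.A.prec a a' ∧ Covers C a' U :=
  Hom.rounded_left C.a a _

theorem covers_iff_right {a : C.A} {U : Finset (Finset C.A)} :
    Covers C a U ↔ ∃ V, Covers C a V ∧ ∀ B ∈ U, ∃ A ∈ V, ∀ a ∈ A, ∃ b ∈ B, C.A.prec a b := by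
  refine (Hom.rounded_right C.a a (doubleMk U)).trans (doubleMk_surjective.exists.trans ?_)
  refine exists_congr fun V => and_congr_right fun _ => ?_
  refine (doublePowerlocale_map_rel (𝟙 C.A) (doubleMk V) (doubleMk U)).trans ?_
  refine (forall_doubleMk (fun B B' h h' => ?_) U).trans (forall₂_congr fun B _ => ?_)
  · obtain ⟨A, hA, h'⟩ := h'
    exact ⟨A, hA, fun a ha => LowerPt.exists_rep_mono
      (fun _ _ h h' => prec_le_right (S := C.A) h' h) h (h' a ha)⟩
  · refine Iff.trans ?_ (exists_doubleMk_forall (p := fun a => ∃ b ∈ B, C.A.prec a b) ?_ V)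
    · exact exists_congr fun A => and_congr_right fun _ => forall₂_congr fun a _ =>
        LowerPt.exists_rep_mk (fun _ _ h h' => prec_le_right (S := C.A) h' h) B
    · rintro a a' h ⟨b, hb, hab⟩
      exact ⟨b, hb, prec_le_left h hab⟩

/-- The counit law in elementary form: by roundedness `a` is related to some `x ≺ {{b}}`, and `x ≺
{{b}}` is exactly what the counit requires of `x` and `b`. -/
theorem covers_singleton {a b : C.A} : Covers C a {{b}} ↔ C.A.prec a b := by
  have h : Hom.rel (C.a ≫ doublePowerlocale.ε.app C.A) a b ↔ C.A.prec a b := by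
    rw [C.counit]
    exact Iff.rfl
  refine Iff.trans ?_ h
  refine (Hom.rounded_right C.a a (doubleMk {{b}})).trans ?_
  refine exists_congr fun x => and_congr_right fun _ => ?_
  refine Iff.trans ?_ (doublePowerlocale_counit_rel (S := C.A) x b).symm
  refine (doublePowerlocale_map_rel (𝟙 C.A) x (doubleMk {{b}})).trans ?_
  refine (forall_doubleMk (fun B B' h h' => ?_) _).trans ?_
  · obtain ⟨A, hA, h'⟩ := h'
    exact ⟨A, hA, fun a ha => LowerPt.exists_rep_mono
      (fun _ _ h h' => prec_le_right (S := C.A) h' h) h (h' a ha)⟩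
  · simp only [Finset.mem_singleton, forall_eq]
    exact exists_congr fun A => and_congr_right fun _ => forall₂_congr fun a _ =>
      exists_rep_singleton

/-- Coassociativity in elementary form, for a meet `W` of joins of meets of joins. The first side is
the comultiplication, with lower sets `p` instead of transversals as in `forall_starU_iff`, so that
no representatives of classes occur in the choice of `p`. The second side applies the structure map
twice. -/
theorem covers_coassoc (a : C.A) (W : Finset (Finset (Finset (Finset C.A)))) :
    (∃ U, Covers C a U ∧ ∀ D ∈ W, ∀ p : LowerPt C.A → Prop, (∀ A B, A ≤ B → p B → p A) →
      (∀ V ∈ D, ∃ A ∈ V, p (LowerPt.mk A)) →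
        ∃ A ∈ U, ∀ a ∈ A, ∃ y, p y ∧ ∃ b ∈ y.rep, C.A.prec a b) ↔
      ∃ U, Covers C a U ∧ ∀ D ∈ W, ∃ A ∈ U, ∀ a ∈ A, ∃ V ∈ D, Covers C a V := by
  classical
  have h : Hom.rel (C.a ≫ doublePowerlocale.δ.app C.A) a
      (doubleMk (S := UpperPt (LowerPt C.A)) (W.image fun D => D.image doubleMk)) ↔
        Hom.rel (C.a ≫ doublePowerlocale.map C.a) a
          (doubleMk (S := UpperPt (LowerPt C.A)) (W.image fun D => D.image doubleMk)) := by rw [C.coassoc]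
  refine Iff.trans ?_ (h.trans ?_)
  · refine Iff.trans ?_ doubleMk_surjective.exists.symm
    refine exists_congr fun U => and_congr_right fun _ => ?_
    refine Iff.trans ?_ (doublePowerlocale_comult_rel _ _).symm
    refine Iff.trans ?_ (forall₂_congr fun D _ => forall_starU_iff (q := C.A.prec)
      (fun _ _ _ h h' => prec_le_right h' h) _ D).symm
    refine Iff.trans ?_ (forall_doubleMk ?_ _).symm
    · rw [Finset.forall_mem_image]
      refine forall₂_congr fun D _ => forall_congr' fun p => forall_congr' fun hp => ?_
      refine imp_congr ?_ ?_
      · refine Iff.trans ?_ (LowerPt.forall_rep_mk (fun V V' h h' =>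
          UpperPt.exists_rep_mono hp h h') _).symm
        rw [Finset.forall_mem_image]
        exact forall₂_congr fun V _ => (exists_doubleMk hp V).symm
      · refine (exists_doubleMk_forall ?_ U).symm
        rintro a a' h ⟨y, hy, b, hb, hab⟩
        exact ⟨y, hy, b, hb, prec_le_left h hab⟩
    · intro D D' h h' p hp hD
      exact h' p hp (LowerPt.forall_rep_mono (fun V V' h h' =>
          UpperPt.exists_rep_mono hp h h') h hD)
  · refine doubleMk_surjective.exists.trans ?_
    refine exists_congr fun U => and_congr_right fun _ => ?_
    refine (doublePowerlocale_map_rel C.a _ _).trans ?_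
    refine (forall_doubleMk ?_ _).trans ?_
    · rintro D D' h ⟨A, hA, h'⟩
      exact ⟨A, hA, fun a ha => LowerPt.exists_rep_mono
        (fun _ _ h h' => Hom.le_right C.a h' h) h (h' a ha)⟩
    · refine Finset.forall_mem_image.trans (forall₂_congr fun D _ => ?_)
      refine Iff.trans ?_ (exists_doubleMk_forall (p := fun a => ∃ V ∈ D, Covers C a V) ?_ U)
      · refine exists_congr fun A => and_congr_right fun _ => forall₂_congr fun a _ => ?_
        refine (LowerPt.exists_rep_mk (fun _ _ h h' => Hom.le_right C.a h' h) _).trans ?_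
        exact Finset.exists_mem_image
      · rintro a a' h ⟨V, hV, ha⟩
        exact ⟨V, hV, Hom.le_left C.a h ha⟩

/-- What is covered by each of finitely many joins is covered by their meet. -/
theorem covers_of_forall {a c : C.A} (hac : C.A.prec a c) {U : Finset (Finset C.A)}
    (h : ∀ A ∈ U, Covers C c {A}) : Covers C a U := by
  classical
  -- Each `A ∈ U` enters as the one-fold join of the one-fold meet of `A`. With `{{c}}` as outer
  -- cover, the second side of coassociativity is then the hypothesis.
  obtain ⟨V, hV, hVU⟩ := (covers_coassoc a (U.image fun A => {{A}})).2
    ⟨{{c}}, covers_singleton.2 hac, by simpa using h⟩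
  refine covers_iff_right.2 ⟨V, hV, fun B hB => ?_⟩
  -- The principal lower set of the class of `B` is the least `p` allowed.
  obtain ⟨A, hA, hAB⟩ := hVU {{B}} (Finset.mem_image_of_mem _ hB) (fun y => y ≤ LowerPt.mk B)
    (fun _ _ => le_trans) (by simp)
  refine ⟨A, hA, fun a ha => ?_⟩
  obtain ⟨y, hy, b, hb, hab⟩ := hAB a ha
  obtain ⟨b', hb', hbb'⟩ := LowerPt.le_mk_iff.1 hy b hb
  exact ⟨b', hb', prec_le_right hab hbb'⟩

variable (C) in
/-- The rounded ideals of the proximity poset underlying a coalgebra. -/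
def Points : Type u := RoundedIdeal C.A

/-! ### Joins of rounded ideals and the frame law. -/

namespace Points

instance : SetLike (Points C) C.A := inferInstanceAs (SetLike (RoundedIdeal C.A) C.A)

instance : PartialOrder (Points C) := inferInstanceAs (PartialOrder (RoundedIdeal C.A))

theorem exists_prec {I : Points C} {a : C.A} (ha : a ∈ I) : ∃ b ∈ I, C.A.prec a b :=
  (RoundedIdeal.mem_iff I).1 ha

/-- The rounded ideal of the elements covered by `U`. -/
def covered (U : Finset (Finset C.A)) : Points C where
  carrier := {a | Covers C a U}
  isIdeal := (Hom.approx C.a).isIdeal (doubleMk U)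
  rounded _ := covers_iff_left.trans (exists_congr fun _ => and_comm)

/-- The finite set `A` has an upper bound `k` in the ideal `I`, so a cover by `A` weakens to a cover
by `{{k}}`, which is `≺ k`. -/
theorem covered_le {U : Finset (Finset C.A)} {A : Finset C.A} (hA : A ∈ U) {I : Points C}
    (h : ∀ a ∈ A, a ∈ I) : covered U ≤ I := by
  intro a ha
  obtain ⟨k, hk, hAk⟩ := exists_upper_bound (RoundedIdeal.isIdeal I) A h
  refine RoundedIdeal.mem_of_prec I (covers_singleton.1 ?_) hk
  exact covers_mono (by simpa using hAk) (covers_of_mem hA ha)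

/-- The union of the ideals need not be an ideal; it is closed up under covers by finite joins of
its elements. -/
instance : SupSet (Points C) where
  sSup s :=
    { carrier := {a | ∃ F : Finset C.A, (∀ b ∈ F, ∃ I ∈ s, b ∈ I) ∧ Covers C a {F}}
      isIdeal :=
        { IsLowerSet := fun a b h ⟨F, hF, ha⟩ => ⟨F, hF, Hom.le_left C.a h ha⟩
          Nonempty :=
            -- The empty join is covered by something, which also settles the case of empty `s`.
            let ⟨a, ha⟩ := ((Hom.approx C.a).isIdeal (doubleMk {∅})).Nonempty
            ⟨a, ∅, by simp, ha⟩
          Directed := by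
            classical
            rintro a ⟨F, hF, ha⟩ b ⟨G, hG, hb⟩
            obtain ⟨c, hc, hac, hbc⟩ := ((Hom.approx C.a).isIdeal (doubleMk {F ∪ G})).Directed
              a (covers_mono (by simpa using fun x hx => ⟨x, Or.inl hx, le_rfl⟩) ha)
              b (covers_mono (by simpa using fun x hx => ⟨x, Or.inr hx, le_rfl⟩) hb)
            refine ⟨c, ⟨F ∪ G, fun x hx => ?_, hc⟩, hac, hbc⟩
            rcases Finset.mem_union.1 hx with hx | hx
            exacts [hF x hx, hG x hx] }
      rounded := fun a => by
        constructor
        · rintro ⟨F, hF, ha⟩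
          obtain ⟨b, hab, hb⟩ := covers_iff_left.1 ha
          exact ⟨b, ⟨F, hF, hb⟩, hab⟩
        · rintro ⟨b, ⟨F, hF, hb⟩, hab⟩
          exact ⟨F, hF, covers_iff_left.2 ⟨b, hab, hb⟩⟩ }

theorem isLUB_sSup (s : Set (Points C)) : IsLUB s (sSup s) := by
  constructor
  · intro I hI a ha
    obtain ⟨b, hb, hab⟩ := exists_prec ha
    exact ⟨{b}, by simpa using ⟨I, hI, hb⟩, covers_singleton.2 hab⟩
  · rintro J hJ a ⟨F, hF, ha⟩
    refine covered_le (Finset.mem_singleton_self F) (fun b hb => ?_) ha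
    obtain ⟨I, hI, hbI⟩ := hF b hb
    exact hJ hI hbI

instance : CompleteLattice (Points C) := completeLatticeOfSup _ isLUB_sSup

/-- Coassociativity rewrites the meet of `c` with the join of `G` as the join over `f ∈ F` of the
meets of `d` and `f`, where `c ≺ d` and `G` is below `F` for `≺`. Each such meet lies in some `I ⊓
J`. -/
theorem inf_sSup_le (I : Points C) (s : Set (Points C)) : I ⊓ sSup s ≤ ⨆ J ∈ s, I ⊓ J := by
  classical
  rw [← sSup_image]
  intro a ha
  -- The chain `a ≺ b ≺ c ≺ d` supplies the slack: `a ≺ b` for `covers_of_forall`, `b ≺ c` for the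
  -- two covers of `b`, `c ≺ d` for coassociativity.
  obtain ⟨b, hb, hab⟩ := exists_prec ha
  obtain ⟨c, hc, hbc⟩ := exists_prec hb
  obtain ⟨d, hd, hcd⟩ := exists_prec hc
  obtain ⟨F, hF, hcF⟩ := (inf_le_right : I ⊓ sSup s ≤ sSup s) hc
  obtain ⟨V, hV, hVF⟩ := covers_iff_right.1 hcF
  obtain ⟨G, hG, hGF⟩ := hVF F (Finset.mem_singleton_self F)
  have h : Covers C a {{c}, G} := by
    refine covers_of_forall hab fun A hA => ?_
    rcases Finset.mem_insert.1 hA with rfl | hA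
    · exact covers_singleton.2 hbc
    · rw [Finset.mem_singleton.1 hA]
      exact covers_iff_left.2 ⟨c, hbc, covers_of_mem hG hV⟩
  obtain ⟨U, hU, hUW⟩ := (covers_coassoc a {F.image fun f => {{d}, {f}}}).1 ⟨_, h, by
    simp only [Finset.mem_singleton, forall_eq, Finset.forall_mem_image, Finset.mem_insert,
      exists_eq_or_imp, exists_eq_left]
    intro p _ hp
    -- A lower set `p` meeting every pair `{d}`, `{f}` contains `{d}`, and then `{c}` is the
    -- required member, or it contains all `{f}`, and then `G` is.
    by_cases hd : p (LowerPt.mk {d})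
    · exact Or.inl ⟨_, hd, exists_rep_singleton.2 hcd⟩
    · refine Or.inr fun g hg => ?_
      obtain ⟨f, hf, hgf⟩ := hGF g hg
      exact ⟨_, (hp hf).resolve_left hd, exists_rep_singleton.2 hgf⟩⟩
  obtain ⟨A, hA, hAF⟩ := hUW _ (Finset.mem_singleton_self _)
  refine ⟨A, fun x hx => ?_, covers_of_mem hA hU⟩
  obtain ⟨V, hV, hxV⟩ := hAF x hx
  obtain ⟨f, hf, rfl⟩ := Finset.mem_image.1 hV
  obtain ⟨J, hJ, hfJ⟩ := hF f hf
  refine ⟨I ⊓ J, ⟨J, hJ, rfl⟩, ?_⟩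
  have h1 : covered {{d}, {f}} ≤ I := covered_le (A := {d}) (by simp) fun x hx => by
    rw [Finset.mem_singleton.1 hx]
    exact (inf_le_left : I ⊓ sSup s ≤ I) hd
  have h2 : covered {{d}, {f}} ≤ J := covered_le (A := {f}) (by simp) (by simpa using hfJ)
  exact le_inf h1 h2 hxV

instance : Order.Frame (Points C) :=
  Order.Frame.ofMinimalAxioms { inf_sSup_le_iSup_inf := inf_sSup_le }

/-! ### Continuity of the frame of rounded ideals. -/

/-- By directedness the finite set `F` lies inside a single ideal of `s`, and `covered_le` puts
whatever it covers there too. -/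
theorem mem_sSup_of_directed {s : Set (Points C)} (hs : s.Nonempty) (hs' : DirectedOn (· ≤ ·) s)
    {a : C.A} : a ∈ sSup s ↔ ∃ I ∈ s, a ∈ I := by
  classical
  constructor
  · rintro ⟨F, hF, ha⟩
    have h : ∃ I ∈ s, ∀ b ∈ F, b ∈ I := by
      clear ha
      induction F using Finset.induction_on with
      | empty => exact ⟨hs.some, hs.some_mem, by simp⟩
      | insert b F _ ih =>
        obtain ⟨I, hI, hFI⟩ := ih fun x hx => hF x (Finset.mem_insert_of_mem hx)
        obtain ⟨J, hJ, hbJ⟩ := hF b (Finset.mem_insert_self b F)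
        obtain ⟨K, hK, hIK, hJK⟩ := hs' I hI J hJ
        refine ⟨K, hK, fun x hx => ?_⟩
        rcases Finset.mem_insert.1 hx with rfl | hx
        exacts [hJK hbJ, hIK (hFI x hx)]
    obtain ⟨I, hI, hFI⟩ := h
    exact ⟨I, hI, covered_le (Finset.mem_singleton_self F) hFI ha⟩
  · rintro ⟨I, hI, ha⟩
    exact (isLUB_sSup s).1 hI ha

/-- The rounded ideal of all elements `≺ b`. -/
def principal (b : C.A) : Points C := RoundedIdeal.principal b

theorem principal_le {I : Points C} {b : C.A} (hb : b ∈ I) : principal b ≤ I :=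
  RoundedIdeal.principal_le hb

theorem directedOn_principal (I : Points C) :
    DirectedOn (· ≤ ·) {J | ∃ b ∈ I, J = principal b} := by
  rintro _ ⟨a, ha, rfl⟩ _ ⟨b, hb, rfl⟩
  obtain ⟨c, hc, hac, hbc⟩ := (RoundedIdeal.isIdeal I).Directed a ha b hb
  exact ⟨_, ⟨c, hc, rfl⟩, fun _ h => prec_le_right h hac, fun _ h => prec_le_right h hbc⟩

/-- By roundedness `J` is the directed join of the principal ideals of its elements. Conversely, a
single `b ∈ J` already lies in one member of any directed family whose join contains `J`. -/
theorem wayBelow_iff {I J : Points C} : WayBelow I J ↔ ∃ b ∈ J, I ≤ principal b := by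
  constructor
  · intro h
    obtain ⟨b, hb⟩ := (RoundedIdeal.isIdeal J).Nonempty
    obtain ⟨_, ⟨b, hb, rfl⟩, hI⟩ := h {K | ∃ b ∈ J, K = principal b} ⟨_, b, hb, rfl⟩
      (directedOn_principal J) fun a ha => by
        obtain ⟨b, hb, hab⟩ := exists_prec ha
        exact (isLUB_sSup {K | ∃ b ∈ J, K = principal b}).1 ⟨b, hb, rfl⟩ hab
    exact ⟨b, hb, hI⟩
  · rintro ⟨b, hb, hI⟩ s hs hs' hJ
    obtain ⟨K, hK, hbK⟩ := (mem_sSup_of_directed hs hs').1 (hJ hb)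
    exact ⟨K, hK, hI.trans (principal_le hbK)⟩

theorem isContinuousLattice : IsContinuousLattice (Points C) := by
  intro I
  refine ⟨?_, ?_, ?_⟩
  · obtain ⟨b, hb⟩ := (RoundedIdeal.isIdeal I).Nonempty
    exact ⟨principal b, wayBelow_iff.2 ⟨b, hb, le_rfl⟩⟩
  · intro J hJ K hK
    obtain ⟨a, ha, hJa⟩ := wayBelow_iff.1 hJ
    obtain ⟨b, hb, hKb⟩ := wayBelow_iff.1 hK
    obtain ⟨_, ⟨c, hc, rfl⟩, hac, hbc⟩ :=
      directedOn_principal I _ ⟨a, ha, rfl⟩ _ ⟨b, hb, rfl⟩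
    exact ⟨principal c, wayBelow_iff.2 ⟨c, hc, le_rfl⟩, hJa.trans hac, hKb.trans hbc⟩
  · refine le_antisymm (sSup_le fun J hJ => hJ.le) fun a ha => ?_
    obtain ⟨b, hb, hab⟩ := exists_prec ha
    exact (isLUB_sSup _).1 (wayBelow_iff.2 ⟨b, hb, le_rfl⟩) hab

/-! ### The isomorphism between a coalgebra and that of its rounded ideals. -/

variable (C) in
/-- The coalgebra given by the frame of rounded ideals of a coalgebra. -/
noncomputable abbrev coalgebra : doublePowerlocale.{u}.Coalgebra :=
  coalgebraOfFrame (Points C) isContinuousLattice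

variable (C) in
/-- A proximity poset is isomorphic to the one given by its rounded ideals. -/
def isoPoints : C.A ≅ ofContinuousLattice (Points C) isContinuousLattice where
  hom :=
    { rel := fun a I => a ∈ I
      approx := ⟨fun I => RoundedIdeal.isIdeal I, fun _ _ _ h h' => h h'⟩
      rounded_left := fun a I =>
        (RoundedIdeal.mem_iff I).trans (exists_congr fun _ => and_comm)
      rounded_right := fun a I => by
        constructor
        · intro ha
          obtain ⟨b, hb, hab⟩ := exists_prec ha
          exact ⟨principal b, hab, wayBelow_iff.2 ⟨b, hb, le_rfl⟩⟩
        · rintro ⟨J, ha, hJ⟩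
          exact hJ.le ha }
  inv :=
    { rel := fun I b => WayBelow I (principal b)
      approx := ⟨fun b => isContinuousLattice.isIdeal _, fun _ _ _ h h' =>
        WayBelow.trans_le h' fun _ h'' => prec_le_right h'' h⟩
      rounded_left := fun I b =>
        (ofContinuousLattice (Points C) isContinuousLattice).rounded I (principal b)
      rounded_right := fun I b => by
        constructor
        · intro h
          obtain ⟨c, hc, hI⟩ := wayBelow_iff.1 h
          obtain ⟨d, hcd, hdb⟩ := (C.A.rounded c b).1 hc
          exact ⟨d, wayBelow_iff.2 ⟨c, hcd, hI⟩, hdb⟩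
        · rintro ⟨d, h, hdb⟩
          exact h.trans_le (principal_le hdb) }
  hom_inv_id := by
    refine hom_ext fun a b => ?_
    constructor
    · rintro ⟨I, ha, hI⟩
      exact WayBelow.le hI ha
    · intro h
      obtain ⟨c, hac, hcb⟩ := (C.A.rounded a b).1 h
      exact ⟨principal c, hac, wayBelow_iff.2 ⟨c, hcb, le_rfl⟩⟩
  inv_hom_id := by
    refine hom_ext fun I J => ?_
    constructor
    · rintro ⟨b, hI, hb⟩
      exact WayBelow.trans_le hI (principal_le hb)
    · intro h
      obtain ⟨b, hb, hI⟩ := wayBelow_iff.1 h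
      obtain ⟨c, hc, hbc⟩ := exists_prec hb
      exact ⟨c, wayBelow_iff.2 ⟨b, hbc, hI⟩, hc⟩

variable (C) in
/-- A coalgebra of the double powerlocale is isomorphic to the one given by its frame of rounded
ideals. -/
noncomputable def coalgebraIso : C ≅ coalgebra C :=
  Comonad.Coalgebra.isoMk (isoPoints C) <| by
    refine hom_ext fun a y => ?_
    -- By roundedness, membership followed by the structure map of the frame says that `a ∈ meetJoin
    -- id y`.
    refine Iff.trans ?_ ((isoPoints C).hom.rounded_right a (meetJoin id y))
    refine doubleMk_surjective.exists.trans ?_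
    have h : ∀ U, Hom.rel (doublePowerlocale.map (isoPoints C).hom) (doubleMk U) y ↔
        ∀ B ∈ UpperPt.rep y, ∃ A ∈ U, ∀ a ∈ A, ∃ I ∈ LowerPt.rep B, a ∈ I := by
      intro U
      refine (doublePowerlocale_map_rel _ _ _).trans (forall₂_congr fun B _ => ?_)
      refine exists_doubleMk_forall ?_ U
      rintro a a' h ⟨I, hI, ha⟩
      exact ⟨I, hI, (RoundedIdeal.isIdeal I).IsLowerSet h ha⟩
    constructor
    · rintro ⟨U, hU, hUy⟩
      have hUy' : covered U ≤ meetJoin id y := by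
        refine le_meetJoin_iff.2 fun B hB => ?_
        obtain ⟨A, hA, hAB⟩ := (h U).1 hUy B hB
        refine covered_le hA fun a ha => ?_
        obtain ⟨I, hI, haI⟩ := hAB a ha
        exact Finset.le_sup (f := id) hI haI
      exact hUy' hU
    · intro ha
      obtain ⟨b, hb, hab⟩ := exists_prec ha
      have h' : ∀ B ∈ UpperPt.rep y, ∃ F : Finset C.A,
          (∀ b ∈ F, ∃ I ∈ LowerPt.rep B, b ∈ I) ∧ Covers C b {F} := by
        intro B hB
        have hbB := meetJoin_le (f := id) hB hb
        -- Written as `sSup`, a finite join of ideals has membership that unfolds to a finite cover.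
        rwa [Finset.sup_id_eq_sSup] at hbB
      obtain ⟨U, h1, h2⟩ := exists_finset_choice _ h'
      -- The separate covers of `b`, one for each `B`, combine into one cover of `a ≺ b`.
      refine ⟨U, covers_of_forall hab fun A hA => ?_, (h U).2 fun B hB => ?_⟩
      · obtain ⟨B, -, -, h⟩ := h2 A hA
        exact h
      · obtain ⟨A, hA, h, -⟩ := h1 B hB
        exact ⟨A, hA, h⟩

end Points

end Coalgebra

instance : localeToCoalgebra.{u}.EssSurj where
  mem_essImage C := ⟨⟨Locale.of (Points C), Points.isContinuousLattice⟩,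
    ⟨(Points.coalgebraIso C).symm⟩⟩

instance : localeToCoalgebra.{u}.IsEquivalence where

end PxPos

theorem mainTheorem3 :
    Nonempty (PxPos.doublePowerlocale.{u}.Coalgebra ≌ LocallyCompactLocale.{u}) :=
  ⟨PxPos.localeToCoalgebra.asEquivalence.symm⟩
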